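/- There is a choice of parameters $T(n)=\Theta(\log^6 n)$, $m(n,\varepsilon)=\tilde\Theta(\log^6 n/\varepsilon^2)$, $D(n)=\tilde\Theta(\log^3 n)$, where all implied constants and exponents are absolute and the bounds hold uniformly over integers $n\ge 2$ and reals $0<\varepsilon\le 1$, such that the following holds for all such $n,\varepsilon$. Consider two unknown distributions $p,q$ on $[n]=\{1,\dots,n\}$. A conditional sampling oracle for $p$ takes a nonempty set $S\subseteq[n]$ and returns $i\in S$ with probability $p(i)/p(S)$ if $p(S)>0$, and a uniformly random $i\in S$ if $p(S)=0$; an algorithm has NACOND (non-adaptive) access if it fixes all its query sets before seeing any answer. The algorithm ANACONDA runs $T=T(n)$ independent rounds. In each round it draws $j\in\{1,\dots,2\lceil\log_2 n\rceil\}$ uniformly at random and a random set $S\subseteq[n]$ containing each $i\in[n]$ independently with probability $2^{-j}$; if $S\neq\emptyset$, it makes $m=m(n,\varepsilon)$ queries to the oracle of $p$ and $m$ queries to the oracle of $q$ on the set $S$, and forms the empirical distributions $\hat p_S,\hat q_S$. It outputs "$d_{\mathrm{TV}}(p,q)\ge\varepsilon$" if in some round there is $i\in S$ with $|\hat p_S(i)-\hat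 q_S(i)|\ge \varepsilon' = \varepsilon/D(n)$, and outputs "$p=q$" otherwise. Then ANACONDA is a non-adaptive algorithm which makes at most $\tilde O\left(\frac{\log^{12} n}{\varepsilon^2}\right)$ queries to the oracle of each distribution and distinguishes $p=q$ from $d_{\mathrm{TV}}(p,q)\ge\varepsilon$ with probability at least $2/3$: for all $p,q$, if $p=q$ it outputs "$p=q$" with probability at least $2/3$, and if $d_{\mathrm{TV}}(p,q)=\frac12\sum_{i}|p(i)-q(i)|\ge\varepsilon$ it outputs "$d_{\mathrm{TV}}(p,q)\ge\varepsilon$" with probability at least $2/3$. Here $f=\tilde O(g)$ means $f\le C\,g\,\log_2^k(2+g)$ for constants $C,k$, and $f=\tilde\Theta(g)$ means in addition $c\,g\le f\,\log_2^{k}(2+g)$ for constants $c>0$ and $k$. -/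

import Mathlib

open scoped ENNReal

noncomputable section

/-! ### Distributions on `[n]` and conditional sampling -/

/-- A distribution on `[n]` is a `PMF (Fin n)`. Total variation distance:
`d_TV(p, q) = (1/2) ∑ i, |p(i) - q(i)|`. -/
def dTV {n : ℕ} (p q : PMF (Fin n)) : ℝ :=
  (1 / 2) * ∑ i, |(p i).toReal - (q i).toReal|

/-- A query set: a nonempty subset of `[n]`. -/
def QuerySet (n : ℕ) : Type := {S : Finset (Fin n) // S.Nonempty}

open Classical in
/-- The law of the answer of the conditional sampling oracle for `p` to the query set `S`:
`i ∈ S` is returned with probability `p(i) / p(S)` if `p(S) > 0`, and `i ∈ S` is returned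
uniformly at random if `p(S) = 0`. -/
def condOracle {n : ℕ} (p : PMF (Fin n)) (S : QuerySet n) : PMF (Fin n) :=
  if h : ∃ i ∈ (S.1 : Set (Fin n)), i ∈ p.support then p.filter (S.1 : Set (Fin n)) h
  else PMF.uniformOfFinset S.1 S.2

open Classical in
/-- The joint law of finitely many independent random variables with laws `μ i`. -/
def productPMF {ι α : Type} [Fintype ι] [Fintype α] (μ : ι → PMF α) : PMF (ι → α) :=
  PMF.ofFintype (fun x => ∏ i, μ i (x i)) (by
    rw [← Fintype.prod_sum (fun i a => μ i a)]
    refine Finset.prod_eq_one fun i _ => ?_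
    rw [← tsum_fintype (L := .unconditional _)]
    exact (μ i).tsum_coe)

/-! ### Non-adaptive algorithms -/

/-- The two possible outputs of an equivalence tester: "`p = q`" and "`d_TV(p, q) ≥ ε`". -/
inductive Verdict : Type
  | equal
  | far

/-- A randomized algorithm with `NACOND` access to two unknown distributions on `[n]`. It draws
its random coins; the coins alone determine the finite families of all query sets that are
submitted to the two oracles; then the output is a function of the coins and of all the answers. -/
structure NacondAlgorithm (n : ℕ) where
  /-- the possible outcomes of the random coins -/
  Coins : Type
  /-- the law of the coins -/
  law : PMF Coins
  /-- indices of the queries to the first oracle -/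
  IdxP : Coins → Type
  /-- indices of the queries to the second oracle -/
  IdxQ : Coins → Type
  fintypeP : ∀ c, Fintype (IdxP c)
  fintypeQ : ∀ c, Fintype (IdxQ c)
  /-- the query sets submitted to the first oracle -/
  queryP : ∀ c, IdxP c → QuerySet n
  /-- the query sets submitted to the second oracle -/
  queryQ : ∀ c, IdxQ c → QuerySet n
  /-- the output -/
  output : ∀ c, (IdxP c → Fin n) → (IdxQ c → Fin n) → Verdict

attribute [instance] NacondAlgorithm.fintypeP NacondAlgorithm.fintypeQ

namespace NacondAlgorithm

/-- The law of the output when the oracles are those of `p` and `q`. Given the coins, all answers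
are independent, each distributed as the answer of the oracle to the query set submitted. -/
def run {n : ℕ} (A : NacondAlgorithm n) (p q : PMF (Fin n)) : PMF Verdict :=
  A.law.bind fun c =>
    (productPMF fun k => condOracle p (A.queryP c k)).bind fun a =>
      (productPMF fun k => condOracle q (A.queryQ c k)).bind fun b =>
        PMF.pure (A.output c a b)

/-- The algorithm never makes more than `N` queries to either oracle. -/
def QueriesAtMost {n : ℕ} (A : NacondAlgorithm n) (N : ℕ) : Prop :=
  ∀ c, Fintype.card (A.IdxP c) ≤ N ∧ Fintype.card (A.IdxQ c) ≤ N

/-- The algorithm distinguishes `p = q` from `d_TV(p, q) ≥ ε` with probability at least `2/3`. -/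
def DistinguishesEquivalence {n : ℕ} (A : NacondAlgorithm n) (ε : ℝ) : Prop :=
  ∀ p q : PMF (Fin n),
    (p = q → 2 / 3 ≤ (A.run p q Verdict.equal).toReal) ∧
    (ε ≤ dTV p q → 2 / 3 ≤ (A.run p q Verdict.far).toReal)

end NacondAlgorithm

/-! ### The algorithm ANACONDA -/

/-- A random subset of `[n]` containing each `i` independently with probability `1 / 2 ^ j`. -/
def randomSubset (n j : ℕ) : PMF (Finset (Fin n)) :=
  PMF.ofFintype
    (fun S => ∏ i, if i ∈ S then ((2 : ℝ≥0∞) ^ j)⁻¹ else 1 - ((2 : ℝ≥0∞) ^ j)⁻¹) (by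
      have h1 : ((2 : ℝ≥0∞) ^ j)⁻¹ ≤ 1 :=
        ENNReal.inv_le_one.mpr (one_le_pow₀ (by norm_num))
      have h := Finset.prod_add (fun _ : Fin n => ((2 : ℝ≥0∞) ^ j)⁻¹)
        (fun _ => 1 - ((2 : ℝ≥0∞) ^ j)⁻¹) Finset.univ
      simp only [add_tsub_cancel_of_le h1, Finset.prod_const_one, Finset.powerset_univ] at h
      refine Eq.trans ?_ h.symm
      refine Finset.sum_congr rfl fun S _ => ?_
      have e1 : Finset.univ.filter (fun i => i ∈ S) = S := by ext i; simp
      have e2 : Finset.univ.filter (fun i => i ∉ S) = Finset.univ \ S := by ext i; simp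
      rw [Finset.prod_ite, e1, e2])

/-- The law of the set drawn in one round of ANACONDA: draw `j ∈ {1, …, 2 ⌈log₂ n⌉}` uniformly,
then a random set containing each `i` independently with probability `1 / 2 ^ j`. -/
def roundSet (n : ℕ) (hn : 2 ≤ n) : PMF (Finset (Fin n)) :=
  (PMF.uniformOfFinset (Finset.Icc 1 (2 * Nat.clog 2 n)) (by
    have := Nat.clog_pos (b := 2) one_lt_two hn
    exact Finset.nonempty_Icc.mpr (by omega))).bind (randomSubset n)

open Classical in
/-- Empirical probability of the symbol `i` among `m` samples. -/
def empirical {n m : ℕ} (x : Fin m → Fin n) (i : Fin n) : ℝ :=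
  (Finset.univ.filter fun k => x k = i).card / m

open Classical in
/-- ANACONDA with `T` rounds, `m` samples per round and threshold `thr`. The coins are the
independent random sets `S 1, …, S T`. For each round `t` with `S t ≠ ∅`, the set `S t` is
submitted `m` times to either oracle. The output is `far` if in some round some `i ∈ S t` has
empirical probabilities (under the two oracles) that differ by at least `thr`. -/
def anaconda (n : ℕ) (hn : 2 ≤ n) (T m : ℕ) (thr : ℝ) : NacondAlgorithm n where
  Coins := Fin T → Finset (Fin n)
  law := productPMF fun _ => roundSet n hn
  IdxP S := {t : Fin T // (S t).Nonempty} × Fin m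
  IdxQ S := {t : Fin T // (S t).Nonempty} × Fin m
  fintypeP _ := inferInstance
  fintypeQ _ := inferInstance
  queryP S k := ⟨S k.1.1, k.1.2⟩
  queryQ S k := ⟨S k.1.1, k.1.2⟩
  output S a b :=
    if ∃ t : {t : Fin T // (S t).Nonempty}, ∃ i ∈ S t.1,
        thr ≤ |empirical (fun k => a (t, k)) i - empirical (fun k => b (t, k)) i|
    then Verdict.far else Verdict.equal

/-! ### Orders of growth, uniformly over a set of parameters -/

/-- `f = Θ(g)` on `s`. -/
def IsThetaOn {α : Type} (s : Set α) (f g : α → ℝ) : Prop :=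
  ∃ c C : ℝ, 0 < c ∧ 0 < C ∧ ∀ x ∈ s, c * g x ≤ f x ∧ f x ≤ C * g x

/-- `f = Õ(g)` on `s`: `f` is at most `g` times a constant times a power of `log g`
(shifted so that the logarithm is at least `1` for `g ≥ 0`). -/
def IsTildeOOn {α : Type} (s : Set α) (f g : α → ℝ) : Prop :=
  ∃ C : ℝ, 0 < C ∧ ∃ k : ℕ, ∀ x ∈ s, f x ≤ C * g x * Real.logb 2 (2 + g x) ^ k

/-- `f = Θ̃(g)` on `s`: equality up to a constant times a power of `log g`. -/
def IsTildeThetaOn {α : Type} (s : Set α) (f g : α → ℝ) : Prop :=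
  IsTildeOOn s f g ∧
    ∃ c : ℝ, 0 < c ∧ ∃ k : ℕ, ∀ x ∈ s, c * g x ≤ f x * Real.logb 2 (2 + g x) ^ k

/-- The admissible support sizes, `n ≥ 2`. -/
def sizes : Set ℕ := {n | 2 ≤ n}

/-- The admissible pairs `(n, ε)`: `n ≥ 2` and `0 < ε ≤ 1`. -/
def params : Set (ℕ × ℝ) := {x | 2 ≤ x.1 ∧ 0 < x.2 ∧ x.2 ≤ 1}

end

/-! Write `d = p - q`, `e = dTV p q` and `L = ⌈log₂ n⌉`. The core claim is that if `e > 0`, then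
with probability at least of order `L⁻⁵` one round draws a set `S` on which the two conditional
distributions differ at some element by order `e / L³`.

Fix a sampling rate `s = 2⁻ʲ`. Call an element heavy if `|d i| > e s`, and light otherwise. There
are at most `2 / s` heavy elements, so any prescribed few of them are the only heavy ones in `S`
with probability of order `s` to the power of their number. The light elements contribute to `d(S)`
a variable with mean `s G`, where `G` is the light sum of `d`, and variance at most `2 (e s)²`.
Cantelli's inequality keeps it below `s G + t`, with `t = e s / (16 L)`, with probability of order
`L⁻²`, while Markov's inequality keeps `q(S)` of order `L² s`. If `S` contains a heavy `i` with `d i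
≥ t` and the rest of `S` has `d`-sum at most `-t`, then `p i / p(S) - q i / q(S) ≥ t / q(S)`
(`condDiffer_of_erase`).

The rest of `S` is negative enough when `G` is sufficiently negative, or when `G ≤ 0` and a second
heavy element, with negative `d`, is also in `S`. Summing over the choices of these elements in a
dyadic bucket of sufficient mass gives `subsetExp_condDiffer_ge_of_bucket`. That a suitable scale
exists, up to exchanging `p` and `q`, follows from a potential argument (`exists_balanced_step`): at
an unsuitable scale, nearly all the mass removed is paid for by a decrease of `|G|`, which starts at
zero.

The remaining ingredient is concentration of all empirical frequencies with no dependence on `n`.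
The deviation bound for a single symbol carries its probability as a factor, so the union bound over
symbols sums to a constant over `δ`. Repeating the round `Θ(L⁶)` times then suffices. -/

/-! ### Expectations over finite types -/

/-- The expectation of `f` under a distribution on a finite type. -/
noncomputable def pmfExp {α : Type} [Fintype α] (μ : PMF α) (f : α → ℝ) : ℝ :=
  ∑ a, (μ a).toReal * f a

open Classical in
/-- The probability of a predicate under a distribution on a finite type. -/
noncomputable def pmfPr {α : Type} [Fintype α] (μ : PMF α) (P : α → Prop) : ℝ :=
  pmfExp μ fun a => if P a then 1 else 0

section Expectation

variable {α : Type} [Fintype α]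

theorem sum_toReal_pmf (μ : PMF α) : ∑ a, (μ a).toReal = 1 := by
  rw [← ENNReal.toReal_sum fun a _ => μ.apply_ne_top a, ← tsum_fintype (L := .unconditional _),
    μ.tsum_coe, ENNReal.toReal_one]

theorem toReal_pmf_le_one {α : Type} (μ : PMF α) (a : α) : (μ a).toReal ≤ 1 :=
  ENNReal.toReal_le_of_le_ofReal zero_le_one (by simpa using μ.coe_le_one a)

theorem pmfExp_const (μ : PMF α) (c : ℝ) : pmfExp μ (fun _ => c) = c := by
  rw [pmfExp, ← Finset.sum_mul, sum_toReal_pmf, one_mul]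

theorem pmfExp_mono (μ : PMF α) {f g : α → ℝ} (h : ∀ a, f a ≤ g a) : pmfExp μ f ≤ pmfExp μ g :=
  Finset.sum_le_sum fun a _ => mul_le_mul_of_nonneg_left (h a) ENNReal.toReal_nonneg

theorem pmfExp_add (μ : PMF α) (f g : α → ℝ) :
    pmfExp μ (fun a => f a + g a) = pmfExp μ f + pmfExp μ g := by
  simp only [pmfExp, mul_add, Finset.sum_add_distrib]

theorem pmfExp_sub (μ : PMF α) (f g : α → ℝ) :
    pmfExp μ (fun a => f a - g a) = pmfExp μ f - pmfExp μ g := by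
  simp only [pmfExp, mul_sub, Finset.sum_sub_distrib]

theorem pmfExp_const_mul (μ : PMF α) (c : ℝ) (f : α → ℝ) :
    pmfExp μ (fun a => c * f a) = c * pmfExp μ f := by
  simp only [pmfExp, Finset.mul_sum]
  exact Finset.sum_congr rfl fun a _ => by ring

theorem pmfExp_sum {κ : Type} (μ : PMF α) (s : Finset κ) (f : κ → α → ℝ) :
    pmfExp μ (fun a => ∑ k ∈ s, f k a) = ∑ k ∈ s, pmfExp μ (f k) := by
  simp only [pmfExp, Finset.mul_sum]
  exact Finset.sum_comm

theorem pmfPr_nonneg (μ : PMF α) (P : α → Prop) : 0 ≤ pmfPr μ P :=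
  Finset.sum_nonneg fun a _ => mul_nonneg ENNReal.toReal_nonneg
    (by dsimp only; split_ifs <;> norm_num)

theorem mul_pmfPr_le_pmfExp (μ : PMF α) {P : α → Prop} {f : α → ℝ} {c : ℝ} (h0 : ∀ a, 0 ≤ f a)
    (h1 : ∀ a, P a → c ≤ f a) : c * pmfPr μ P ≤ pmfExp μ f := by
  rw [pmfPr, ← pmfExp_const_mul]
  refine pmfExp_mono μ fun a => ?_
  split_ifs with h
  · simpa using h1 a h
  · simpa using h0 a

theorem pmfPr_le_pmfExp (μ : PMF α) {P : α → Prop} {f : α → ℝ} (h0 : ∀ a, 0 ≤ f a)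
    (h1 : ∀ a, P a → 1 ≤ f a) : pmfPr μ P ≤ pmfExp μ f :=
  (one_mul _).symm.trans_le (mul_pmfPr_le_pmfExp μ h0 h1)

theorem pmfPr_mono (μ : PMF α) {P R : α → Prop} (h : ∀ a, P a → R a) : pmfPr μ P ≤ pmfPr μ R :=
  pmfExp_mono μ fun a => by
    by_cases hP : P a
    · simp [hP, h a hP]
    · rw [if_neg hP]; split_ifs <;> norm_num

theorem pmfPr_exists_le {κ : Type} [Fintype κ] (μ : PMF α) (P : κ → α → Prop) :
    pmfPr μ (fun a => ∃ k, P k a) ≤ ∑ k, pmfPr μ (P k) := by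
  classical
  simp only [pmfPr]
  rw [← pmfExp_sum]
  refine pmfExp_mono μ fun a => ?_
  have h0 : ∀ k ∈ Finset.univ, (0 : ℝ) ≤ if P k a then 1 else 0 := fun k _ => by
    split_ifs <;> norm_num
  split_ifs with h
  · obtain ⟨k, hk⟩ := h
    calc (1 : ℝ) = if P k a then 1 else 0 := by rw [if_pos hk]
      _ ≤ _ := Finset.single_le_sum h0 (Finset.mem_univ k)
  · exact Finset.sum_nonneg h0

theorem pmfPr_or_le (μ : PMF α) (P R : α → Prop) :
    pmfPr μ (fun a => P a ∨ R a) ≤ pmfPr μ P + pmfPr μ R := by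
  classical
  simp only [pmfPr]
  rw [← pmfExp_add]
  refine pmfExp_mono μ fun a => ?_
  by_cases h1 : P a <;> by_cases h2 : R a <;> simp [h1, h2]

theorem pmfPr_not (μ : PMF α) (P : α → Prop) : pmfPr μ (fun a => ¬ P a) = 1 - pmfPr μ P := by
  classical
  rw [pmfPr, pmfPr]
  nth_rw 2 [← pmfExp_const μ (1 : ℝ)]
  rw [← pmfExp_sub]
  refine congrArg _ (funext fun a => ?_)
  by_cases h : P a <;> simp [h]

theorem toReal_bind_apply {β : Type} (μ : PMF α) (f : α → PMF β) (b : β) :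
    (μ.bind f b).toReal = pmfExp μ fun a => (f a b).toReal := by
  rw [PMF.bind_apply, tsum_fintype, ENNReal.toReal_sum fun a _ =>
    ENNReal.mul_ne_top (μ.apply_ne_top a) ((f a).apply_ne_top b)]
  simp only [ENNReal.toReal_mul, pmfExp]

theorem toReal_productPMF_apply {ι : Type} [Fintype ι] (μ : ι → PMF α) (x : ι → α) :
    (productPMF μ x).toReal = ∏ i, (μ i (x i)).toReal := by
  classical
  rw [productPMF, PMF.ofFintype_apply, ENNReal.toReal_prod]

theorem pmfExp_productPMF_prod {ι : Type} [Fintype ι] [DecidableEq ι] (μ : ι → PMF α)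
    (f : ι → α → ℝ) :
    pmfExp (productPMF μ) (fun x => ∏ i, f i (x i)) = ∏ i, pmfExp (μ i) (f i) := by
  simp only [pmfExp, toReal_productPMF_apply, ← Finset.prod_mul_distrib]
  exact (Fintype.prod_sum fun i a => (μ i a).toReal * f i a).symm

theorem pmfPr_productPMF_forall {ι : Type} [Fintype ι] [DecidableEq ι] (μ : ι → PMF α)
    (P : ι → α → Prop) :
    pmfPr (productPMF μ) (fun x => ∀ i, P i (x i)) = ∏ i, pmfPr (μ i) (P i) := by
  classical
  simp only [pmfPr]
  rw [← pmfExp_productPMF_prod]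
  refine congrArg _ (funext fun x => ?_)
  rw [Finset.prod_ite_zero]
  simp

end Expectation

/-! ### Concentration of empirical frequencies -/

section Empirical

variable {n m : ℕ} {ι : Type} [Fintype ι] [DecidableEq ι]

-- The relevant samples are a subfamily `e` of a larger independent family (one round among all
-- answers). Padding the product with factors `1` off the image of `e` avoids passing to a marginal
-- law.
open Classical in
theorem pmfExp_pow_card (μ : ι → PMF (Fin n)) (ν : PMF (Fin n)) (e : Fin m → ι)
    (he : Function.Injective e) (hμ : ∀ k, μ (e k) = ν) (i : Fin n) (c : ℝ) :
    pmfExp (productPMF μ) (fun x => c ^ (Finset.univ.filter fun k => x (e k) = i).card) =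
      (1 + (ν i).toReal * (c - 1)) ^ m := by
  have key : ∀ F : ι → ℝ, ∏ k, F (e k) = ∏ κ, if κ ∈ Finset.univ.image e then F κ else 1 := by
    intro F
    rw [Finset.prod_ite_mem, Finset.univ_inter, Finset.prod_image fun a _ b _ h => he h]
  have h1 : ∀ x : ι → Fin n, c ^ (Finset.univ.filter fun k => x (e k) = i).card =
      ∏ κ, (fun κ (y : Fin n) => if κ ∈ Finset.univ.image e then
        (if y = i then c else 1) else 1) κ (x κ) := by
    intro x
    rw [← key fun κ => if x κ = i then c else 1, Finset.prod_ite]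
    simp
  rw [funext h1]
  refine (pmfExp_productPMF_prod μ fun κ y => if κ ∈ Finset.univ.image e then
    (if y = i then c else 1) else 1).trans ?_
  have h2 : ∀ κ, pmfExp (μ κ) (fun y => if κ ∈ Finset.univ.image e then
      (if y = i then c else 1) else 1) =
      if κ ∈ Finset.univ.image e then (1 + (μ κ i).toReal * (c - 1)) else 1 := by
    intro κ
    split_ifs with h
    · have : ∀ y, (if y = i then c else 1) = 1 + (if y = i then c - 1 else 0) := fun y => by
        split_ifs <;> ring
      simp only [this]
      rw [pmfExp_add, pmfExp_const]
      simp [pmfExp]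
    · exact pmfExp_const _ _
  simp only [h2]
  rw [← key fun κ => 1 + (μ κ i).toReal * (c - 1)]
  simp [hμ]

theorem exp_sub_one_le {x : ℝ} (hx : |x| ≤ 1) : Real.exp x - 1 ≤ x + x ^ 2 := by
  have := (abs_le.mp (Real.abs_exp_sub_one_sub_id_le hx)).2
  linarith

open Classical in
theorem pmfExp_exp_card_le (μ : ι → PMF (Fin n)) (ν : PMF (Fin n)) (e : Fin m → ι)
    (he : Function.Injective e) (hμ : ∀ k, μ (e k) = ν) (i : Fin n) {l : ℝ} (hl : |l| ≤ 1) :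
    pmfExp (productPMF μ)
      (fun x => Real.exp (l * (Finset.univ.filter fun k => x (e k) = i).card)) ≤
      Real.exp (m * ((ν i).toReal * (l + l ^ 2))) := by
  have h1 : ∀ N : ℕ, Real.exp (l * N) = Real.exp l ^ N := fun N => by
    rw [← Real.exp_nat_mul, mul_comm]
  simp only [h1]
  rw [pmfExp_pow_card μ ν e he hμ i, Real.exp_nat_mul]
  have hp0 : 0 ≤ (ν i).toReal := ENNReal.toReal_nonneg
  have hp1 := toReal_pmf_le_one ν i
  refine pow_le_pow_left₀ ?_ ?_ m
  · nlinarith [Real.exp_pos l]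
  · calc 1 + (ν i).toReal * (Real.exp l - 1) ≤ (ν i).toReal * (l + l ^ 2) + 1 := by
          nlinarith [exp_sub_one_le hl]
      _ ≤ _ := Real.add_one_le_exp _

theorem exp_sub_one_le_chord {A B : ℝ} (hA : 0 ≤ A) (hB : 0 < B) (hAB : A ≤ B) :
    Real.exp A - 1 ≤ A / B * (Real.exp B - 1) := by
  have h := convexOn_exp.2 (Set.mem_univ (0 : ℝ)) (Set.mem_univ B) 
    (show 0 ≤ 1 - A / B by rw [sub_nonneg, div_le_one hB]; exact hAB)
    (show 0 ≤ A / B by positivity) (by ring)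
  simp only [smul_eq_mul, mul_zero, zero_add, Real.exp_zero, mul_one] at h
  rw [div_mul_cancel₀ _ hB.ne'] at h
  linarith

/-- The factor `(ν i).toReal` is the point: it makes the union bound over symbols independent of
`n`. For likely symbols it is at least `δ / 2` and comes for free from a two-sided Chernoff bound;
for unlikely ones it comes from applying Markov's inequality to `exp (Y / 2) - 1` instead of `exp (Y
/ 2)`. -/
theorem pmfPr_empirical_sub_ge_le (μ : ι → PMF (Fin n)) (ν : PMF (Fin n)) (e : Fin m → ι)
    (he : Function.Injective e) (hμ : ∀ k, μ (e k) = ν) (hm : 0 < m) (i : Fin n) {δ : ℝ}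
    (h0 : 0 < δ) (h1 : δ ≤ 1) :
    pmfPr (productPMF μ) (fun x => δ ≤ |empirical (fun k => x (e k)) i - (ν i).toReal|) ≤
      4 * (ν i).toReal / δ * Real.exp (-(m * δ ^ 2 / 8)) := by
  classical
  set p := (ν i).toReal with hp
  have hp0 : 0 ≤ p := ENNReal.toReal_nonneg
  have hp1 : p ≤ 1 := toReal_pmf_le_one ν i
  have hm' : (0 : ℝ) < m := by exact_mod_cast hm
  set Y : (ι → Fin n) → ℕ := fun x => (Finset.univ.filter fun k => x (e k) = i).card with hY
  have hemp : ∀ x : ι → Fin n, empirical (fun k => x (e k)) i * m = Y x := fun x => by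
    rw [empirical, div_mul_cancel₀ _ hm'.ne']
  have mgf : ∀ l : ℝ, |l| ≤ 1 → pmfExp (productPMF μ) (fun x => Real.exp (l * Y x)) ≤
      Real.exp (m * (p * (l + l ^ 2))) := fun l hl => pmfExp_exp_card_le μ ν e he hμ i hl
  rcases le_or_gt (δ / 2) p with hpd | hpd
  · have up : pmfPr (productPMF μ) (fun x => m * (p + δ) ≤ Y x) ≤
        Real.exp (-(m * δ ^ 2 / 8)) := by
      calc _ ≤ pmfExp (productPMF μ) (fun x =>
            Real.exp (-(δ / 2 * (m * (p + δ)))) * Real.exp (δ / 2 * Y x)) :=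
            pmfPr_le_pmfExp _ (fun _ => by positivity) fun x hx => by
              rw [← Real.exp_add]
              refine Real.one_le_exp ?_
              nlinarith
        _ ≤ Real.exp (-(δ / 2 * (m * (p + δ)))) *
            Real.exp (m * (p * (δ / 2 + (δ / 2) ^ 2))) := by
            rw [pmfExp_const_mul]
            gcongr
            exact mgf _ (by rw [abs_of_pos (by positivity)]; linarith)
        _ ≤ _ := by
            rw [← Real.exp_add]
            refine Real.exp_le_exp.mpr ?_
            have : 0 ≤ m * δ ^ 2 * (1 - p) := mul_nonneg (by positivity) (by linarith)
            nlinarith [mul_pos hm' (pow_pos h0 2)]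
    have dn : pmfPr (productPMF μ) (fun x => Y x ≤ m * (p - δ)) ≤
        Real.exp (-(m * δ ^ 2 / 8)) := by
      calc _ ≤ pmfExp (productPMF μ) (fun x =>
            Real.exp (δ / 2 * (m * (p - δ))) * Real.exp (-(δ / 2) * Y x)) :=
            pmfPr_le_pmfExp _ (fun _ => by positivity) fun x hx => by
              rw [← Real.exp_add]
              refine Real.one_le_exp ?_
              nlinarith
        _ ≤ Real.exp (δ / 2 * (m * (p - δ))) *
            Real.exp (m * (p * (-(δ / 2) + (-(δ / 2)) ^ 2))) := by
            rw [pmfExp_const_mul]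
            gcongr
            exact mgf _ (by rw [abs_neg, abs_of_pos (by positivity)]; linarith)
        _ ≤ _ := by
            rw [← Real.exp_add]
            refine Real.exp_le_exp.mpr ?_
            have : 0 ≤ m * δ ^ 2 * (1 - p) := mul_nonneg (by positivity) (by linarith)
            nlinarith [mul_pos hm' (pow_pos h0 2)]
    calc _ ≤ pmfPr (productPMF μ) (fun x => m * (p + δ) ≤ Y x ∨ Y x ≤ m * (p - δ)) := by
          refine pmfPr_mono _ fun x hx => ?_
          rw [← hemp x]
          rcases le_abs.mp hx with h | h
          · left; nlinarith
          · right; nlinarith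
      _ ≤ _ := pmfPr_or_le _ _ _
      _ ≤ 2 * Real.exp (-(m * δ ^ 2 / 8)) := by linarith
      _ ≤ _ := by
          gcongr
          rw [le_div_iff₀ h0]
          linarith
  -- Here `p < δ / 2`, so only upward deviations occur. Convexity bounds `exp A - 1` linearly in `A
  -- = 3 m p / 4`, which extracts the factor `p`; the gap `C - B = m δ / 8` supplies the exponential
  -- decay.
  · have hA : m * (p * (1 / 2 + (1 / 2) ^ 2)) = 3 / 4 * (m * p) := by ring
    have hE := mgf (1 / 2) (by rw [abs_of_pos] <;> norm_num)
    rw [hA] at hE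
    set B : ℝ := 3 / 8 * (m * δ) with hB
    have hB0 : 0 < B := by positivity
    have hch := exp_sub_one_le_chord (A := 3 / 4 * (m * p)) (B := B) (by positivity) hB0
      (by rw [hB]; nlinarith)
    have hratio : 3 / 4 * (m * p) / B = 2 * p / δ := by rw [hB]; field_simp; ring
    rw [hratio] at hch
    set C : ℝ := 1 / 2 * (m * δ) with hC
    have hBC : B ≤ C := by rw [hB, hC]; nlinarith [mul_pos hm' h0]
    have hC0 : 0 < Real.exp C - 1 := by
      have := Real.add_one_lt_exp (x := C) (by positivity)
      have : 0 < C := by positivity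
      linarith
    calc _ ≤ pmfExp (productPMF μ) (fun x =>
          (Real.exp C - 1)⁻¹ * (Real.exp (1 / 2 * Y x) - 1)) := by
          refine pmfPr_le_pmfExp _ (fun x => ?_) fun x hx => ?_
          · refine mul_nonneg (by positivity) (sub_nonneg.mpr (Real.one_le_exp (by positivity)))
          · rw [inv_mul_eq_div, le_div_iff₀ hC0, one_mul]
            refine sub_le_sub_right (Real.exp_le_exp.mpr ?_) _
            rw [← hemp x, hC]
            have h00 : 0 ≤ empirical (fun k => x (e k)) i := by unfold empirical; positivity
            rcases le_abs.mp hx with h | h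
            · nlinarith
            · linarith
      _ ≤ (Real.exp C - 1)⁻¹ * (2 * p / δ * (Real.exp B - 1)) := by
          rw [pmfExp_const_mul, pmfExp_sub, pmfExp_const]
          gcongr
          linarith
      _ = 2 * p / δ * ((Real.exp B - 1) / (Real.exp C - 1)) := by ring
      _ ≤ 4 * p / δ * Real.exp (-(m * δ ^ 2 / 8)) := by
          refine mul_le_mul (by gcongr; norm_num) ?_ (div_nonneg (sub_nonneg.mpr
            (Real.one_le_exp hB0.le)) hC0.le) (by positivity)
          · rw [div_le_iff₀ hC0]
            have h2 : Real.exp B ≤ Real.exp (-(m * δ ^ 2 / 8)) * Real.exp C := by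
              rw [← Real.exp_add]
              refine Real.exp_le_exp.mpr ?_
              rw [hB, hC]
              nlinarith [mul_pos hm' h0]
            have h3 : Real.exp (-(m * δ ^ 2 / 8)) ≤ 1 := Real.exp_le_one_iff.mpr (by
              have : 0 ≤ m * δ ^ 2 / 8 := by positivity
              linarith)
            nlinarith

theorem pmfPr_exists_empirical_sub_ge_le (μ : ι → PMF (Fin n)) (ν : PMF (Fin n)) (e : Fin m → ι)
    (he : Function.Injective e) (hμ : ∀ k, μ (e k) = ν) (hm : 0 < m) {δ : ℝ}
    (h0 : 0 < δ) (h1 : δ ≤ 1) :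
    pmfPr (productPMF μ) (fun x => ∃ i, δ ≤ |empirical (fun k => x (e k)) i - (ν i).toReal|) ≤
      4 / δ * Real.exp (-(m * δ ^ 2 / 8)) := by
  refine (pmfPr_exists_le _ _).trans ?_
  calc _ ≤ ∑ i, 4 * (ν i).toReal / δ * Real.exp (-(m * δ ^ 2 / 8)) :=
        Finset.sum_le_sum fun i _ => pmfPr_empirical_sub_ge_le μ ν e he hμ hm i h0 h1
    _ = (∑ i, (ν i).toReal) * (4 / δ * Real.exp (-(m * δ ^ 2 / 8))) := by
        rw [Finset.sum_mul]
        exact Finset.sum_congr rfl fun i _ => by ring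
    _ = _ := by rw [sum_toReal_pmf, one_mul]

end Empirical

/-! ### Random subsets -/

section RandomSubset

variable {α : Type} [DecidableEq α]

/-- The expectation of `F` over a random subset of `U` containing each element independently with
probability `s`. -/
noncomputable def subsetExp (s : ℝ) (U : Finset α) (F : Finset α → ℝ) : ℝ :=
  ∑ S ∈ U.powerset, s ^ S.card * (1 - s) ^ (U \ S).card * F S

theorem subsetExp_empty (s : ℝ) (F : Finset α → ℝ) : subsetExp s ∅ F = F ∅ := by
  simp [subsetExp]

theorem subsetExp_insert (s : ℝ) {U : Finset α} {x : α} (hx : x ∉ U) (F : Finset α → ℝ) :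
    subsetExp s (insert x U) F =
      (1 - s) * subsetExp s U F + s * subsetExp s U fun S => F (insert x S) := by
  simp only [subsetExp]
  rw [Finset.sum_powerset_insert hx, Finset.mul_sum, Finset.mul_sum]
  congr 1
  · refine Finset.sum_congr rfl fun S hS => ?_
    have hxS : x ∉ S := fun h => hx (Finset.mem_powerset.mp hS h)
    rw [Finset.insert_sdiff_of_notMem _ hxS,
      Finset.card_insert_of_notMem fun h => hx (Finset.mem_sdiff.mp h).1, pow_succ]
    ring
  · refine Finset.sum_congr rfl fun S hS => ?_
    have hxS : x ∉ S := fun h => hx (Finset.mem_powerset.mp hS h)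
    have : insert x U \ insert x S = U \ S := by
      ext y
      simp only [Finset.mem_sdiff, Finset.mem_insert]
      constructor
      · rintro ⟨h | h, h'⟩
        · exact absurd (Or.inl h) h'
        · exact ⟨h, fun h2 => h' (Or.inr h2)⟩
      · rintro ⟨h, h'⟩
        exact ⟨Or.inr h, fun h2 => h2.elim (fun h3 => hx (h3 ▸ h)) h'⟩
    rw [Finset.card_insert_of_notMem hxS, this, pow_succ]
    ring

theorem subsetExp_add (s : ℝ) (U : Finset α) (F H : Finset α → ℝ) :
    subsetExp s U (fun S => F S + H S) = subsetExp s U F + subsetExp s U H := by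
  simp only [subsetExp, mul_add, Finset.sum_add_distrib]

theorem subsetExp_const_mul (s : ℝ) (U : Finset α) (c : ℝ) (F : Finset α → ℝ) :
    subsetExp s U (fun S => c * F S) = c * subsetExp s U F := by
  simp only [subsetExp, Finset.mul_sum]
  exact Finset.sum_congr rfl fun S _ => by ring

theorem subsetExp_mono {s : ℝ} (h0 : 0 ≤ s) (h1 : s ≤ 1) {U : Finset α} {F H : Finset α → ℝ}
    (h : ∀ S ⊆ U, F S ≤ H S) : subsetExp s U F ≤ subsetExp s U H :=
  Finset.sum_le_sum fun S hS => mul_le_mul_of_nonneg_left (h S (Finset.mem_powerset.mp hS))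
    (mul_nonneg (pow_nonneg h0 _) (pow_nonneg (sub_nonneg.mpr h1) _))

theorem subsetExp_const (s : ℝ) (U : Finset α) (c : ℝ) : subsetExp s U (fun _ => c) = c := by
  induction U using Finset.induction_on with
  | empty => exact subsetExp_empty s _
  | insert x U hx ih => rw [subsetExp_insert s hx, ih]; ring

theorem subsetExp_sum (s : ℝ) (U : Finset α) (w : α → ℝ) :
    subsetExp s U (fun S => ∑ l ∈ S, w l) = s * ∑ l ∈ U, w l := by
  induction U using Finset.induction_on with
  | empty => simp [subsetExp_empty]
  | insert x U hx ih =>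
    have h : subsetExp s U (fun S => ∑ l ∈ insert x S, w l) =
        subsetExp s U (fun S => w x + ∑ l ∈ S, w l) := Finset.sum_congr rfl fun S hS => by
      dsimp only
      rw [Finset.sum_insert fun h => hx (Finset.mem_powerset.mp hS h)]
    rw [subsetExp_insert s hx, h, subsetExp_add, subsetExp_const, ih, Finset.sum_insert hx]
    ring

theorem subsetExp_sum_sub_sq (s : ℝ) (U : Finset α) (c : α → ℝ) :
    subsetExp s U (fun S => (∑ l ∈ S, c l - s * ∑ l ∈ U, c l) ^ 2) =
      s * (1 - s) * ∑ l ∈ U, c l ^ 2 := by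
  induction U using Finset.induction_on with
  | empty => simp [subsetExp_empty]
  | insert x U hx ih =>
    rw [Finset.sum_insert (f := fun l => c l ^ 2) hx, mul_add, ← ih, add_comm,
      ← subsetExp_const s U (s * (1 - s) * c x ^ 2), ← subsetExp_add, subsetExp_insert s hx,
      ← subsetExp_const_mul, ← subsetExp_const_mul, ← subsetExp_add]
    refine Finset.sum_congr rfl fun S hS => ?_
    dsimp only
    rw [Finset.sum_insert hx, Finset.sum_insert fun h => hx (Finset.mem_powerset.mp hS h)]
    ring

theorem subsetExp_union (s : ℝ) {A U : Finset α} (h : Disjoint A U) (F : Finset α → ℝ) :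
    subsetExp s (A ∪ U) F = subsetExp s A fun R => subsetExp s U fun S => F (R ∪ S) := by
  induction A using Finset.induction_on generalizing F with
  | empty => simp [subsetExp_empty]
  | insert x A hx ih =>
    have hd := Finset.disjoint_insert_left.mp h
    rw [Finset.insert_union, subsetExp_insert s (by simp [hx, hd.1]), ih hd.2, ih hd.2,
      subsetExp_insert s hx]
    simp only [Finset.insert_union]

/-- The events that the random set meets `A` exactly in `ρ x` are disjoint for distinct `x`, and
each has probability at least `s ^ r * (1 - s) ^ A.card`. The part inside `U` is independent of
them. -/
theorem card_mul_le_subsetExp_union {κ : Type} {s c : ℝ} {r : ℕ} (h0 : 0 ≤ s) (h1 : s ≤ 1)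
    (hc : 0 ≤ c) {A U : Finset α} (hAU : Disjoint A U) {F : Finset α → ℝ} (hF : ∀ S, 0 ≤ F S)
    (X : Finset κ) (ρ : κ → Finset α) (hinj : Set.InjOn ρ X) (hρ : ∀ x ∈ X, ρ x ⊆ A)
    (hr : ∀ x ∈ X, (ρ x).card = r)
    (hX : ∀ x ∈ X, c ≤ subsetExp s U fun S => F (ρ x ∪ S)) :
    X.card * (s ^ r * (1 - s) ^ A.card * c) ≤ subsetExp s (A ∪ U) F := by
  have h1' : 0 ≤ 1 - s := sub_nonneg.mpr h1
  have hnn : ∀ R, 0 ≤ subsetExp s U fun S => F (R ∪ S) := fun R => by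
    rw [← subsetExp_const s U 0]
    exact subsetExp_mono h0 h1 fun S _ => hF _
  rw [subsetExp_union s hAU, subsetExp, ← nsmul_eq_mul, ← Finset.sum_const]
  calc _ ≤ ∑ x ∈ X, s ^ (ρ x).card * (1 - s) ^ (A \ ρ x).card *
        subsetExp s U fun S => F (ρ x ∪ S) := by
        refine Finset.sum_le_sum fun x hx => ?_
        rw [hr x hx]
        refine mul_le_mul (mul_le_mul_of_nonneg_left ?_ (by positivity)) (hX x hx) hc
          (by positivity)
        exact pow_le_pow_of_le_one h1' (by linarith) (Finset.card_le_card Finset.sdiff_subset)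
    _ = ∑ R ∈ X.image ρ, s ^ R.card * (1 - s) ^ (A \ R).card *
        subsetExp s U fun S => F (R ∪ S) := by
        rw [Finset.sum_image hinj]
    _ ≤ _ := by
        refine Finset.sum_le_sum_of_subset_of_nonneg ?_ fun R _ _ =>
          mul_nonneg (by positivity) (hnn R)
        intro R hR
        obtain ⟨x, hx, rfl⟩ := Finset.mem_image.mp hR
        exact Finset.mem_powerset.mpr (hρ x hx)

-- Cantelli's one-sided inequality for the first sum, combined with Markov's inequality for the
-- second. The one-sided form matters: `t` will be smaller than the standard deviation bound, where
-- Chebyshev's inequality says nothing.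
open Classical in
theorem subsetExp_sum_le_and_sum_le {s t V M : ℝ} (h0 : 0 ≤ s) (h1 : s ≤ 1) (ht : 0 < t)
    (hM : 0 < M) (U : Finset α) (c w : α → ℝ) (hw : ∀ l, 0 ≤ w l)
    (hV : s * ∑ l ∈ U, c l ^ 2 ≤ V) :
    t ^ 2 / (V + t ^ 2) - s * (∑ l ∈ U, w l) / M ≤
      subsetExp s U fun S =>
        if ∑ l ∈ S, c l ≤ s * (∑ l ∈ U, c l) + t ∧ ∑ l ∈ S, w l ≤ M then 1 else 0 := by
  have hc2 : 0 ≤ ∑ l ∈ U, c l ^ 2 := Finset.sum_nonneg fun l _ => sq_nonneg _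
  have hV0 : 0 ≤ V := (mul_nonneg h0 hc2).trans hV
  set u := V / t with hu
  have hu0 : 0 ≤ u := by positivity
  have hE1 := subsetExp_sum s U c
  have hE2 := subsetExp_sum_sub_sq s U c
  set m := s * ∑ l ∈ U, c l with hm
  set K := ((t + u) ^ 2)⁻¹ with hK
  have hK0 : 0 ≤ K := by positivity
  -- The square `K * (X - m + u) ^ 2` dominates the indicator of `X > m + t`, with the optimal shift
  -- `u = V / t`. It is written expanded so that linearity of the expectation applies termwise.
  have point : ∀ S ⊆ U, 1 + (-K * (∑ l ∈ S, c l - m) ^ 2 + (-(2 * K * u) * (∑ l ∈ S, c l) +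
      (K * (2 * u * m - u ^ 2) + -M⁻¹ * ∑ l ∈ S, w l))) ≤
      if ∑ l ∈ S, c l ≤ m + t ∧ ∑ l ∈ S, w l ≤ M then 1 else 0 := by
    intro S _
    have hwS : 0 ≤ M⁻¹ * ∑ l ∈ S, w l :=
      mul_nonneg (by positivity) (Finset.sum_nonneg fun l _ => hw l)
    have e : 1 + (-K * (∑ l ∈ S, c l - m) ^ 2 + (-(2 * K * u) * (∑ l ∈ S, c l) +
      (K * (2 * u * m - u ^ 2) + -M⁻¹ * ∑ l ∈ S, w l))) =
      1 - K * (∑ l ∈ S, c l - m + u) ^ 2 - M⁻¹ * ∑ l ∈ S, w l := by ring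
    rw [e]
    have hsq : 0 ≤ K * (∑ l ∈ S, c l - m + u) ^ 2 := by positivity
    split_ifs with h
    · linarith
    · rw [not_and_or, not_le, not_le] at h
      rcases h with h | h
      · have : 1 ≤ K * (∑ l ∈ S, c l - m + u) ^ 2 := by
          rw [hK, inv_mul_eq_div, le_div_iff₀ (by positivity), one_mul]
          exact pow_le_pow_left₀ (by positivity) (by linarith) 2
        linarith
      · have : 1 ≤ M⁻¹ * ∑ l ∈ S, w l := by
          rw [inv_mul_eq_div, le_div_iff₀ hM, one_mul]
          exact h.le
        linarith
  refine le_trans ?_ (subsetExp_mono h0 h1 point)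
  simp only [subsetExp_add, subsetExp_const_mul, subsetExp_const, subsetExp_sum]
  rw [hE2, ← hm]
  have hfinal : t ^ 2 / (V + t ^ 2) = 1 - K * (V + u ^ 2) := by
    rw [hK, hu]
    field_simp
    ring
  have hvar : s * (1 - s) * ∑ l ∈ U, c l ^ 2 ≤ V := by nlinarith [mul_nonneg h0 hc2]
  rw [hfinal, div_eq_inv_mul]
  nlinarith

-- Terms of size at most `c` need at least `η / c` indices to reach `η`, and at most `1 / K` indices
-- can have `q`-mass above `K`.
omit [DecidableEq α] in
theorem card_filter_ge_of_sum_ge {c K η : ℝ} (hc : 0 < c) (hK : 0 < K) (B : Finset α)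
    (f q : α → ℝ) (hf : ∀ i ∈ B, f i ≤ c) (hη : η ≤ ∑ i ∈ B, f i) (hq : ∀ i, 0 ≤ q i)
    (hq1 : ∑ i ∈ B, q i ≤ 1) :
    η / c - 1 / K ≤ (B.filter fun i => q i ≤ K).card := by
  have h1 : η / c ≤ B.card := by
    rw [div_le_iff₀ hc]
    calc η ≤ _ := hη
      _ ≤ ∑ i ∈ B, c := Finset.sum_le_sum hf
      _ = _ := by simp
  have h2 : ((B.filter fun i => ¬ q i ≤ K).card : ℝ) ≤ 1 / K := by
    rw [le_div_iff₀ hK]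
    calc _ = ∑ i ∈ B.filter fun i => ¬ q i ≤ K, K := by simp
      _ ≤ ∑ i ∈ B.filter fun i => ¬ q i ≤ K, q i :=
        Finset.sum_le_sum fun i hi => (not_le.mp (Finset.mem_filter.mp hi).2).le
      _ ≤ ∑ i ∈ B, q i :=
        Finset.sum_le_sum_of_subset_of_nonneg (Finset.filter_subset _ _) fun i _ _ => hq i
      _ ≤ 1 := hq1
  have h3 : ((B.filter fun i => q i ≤ K).card : ℝ) + (B.filter fun i => ¬ q i ≤ K).card =
      B.card := by
    exact_mod_cast Finset.card_filter_add_card_filter_not (s := B) (fun i => q i ≤ K)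
  linarith

theorem one_sub_pow_card_ge {N : ℕ} (hN : 0 < N) {s : ℝ} (hs : s = 1 / (2 * N)) {a : ℕ}
    (ha : a ≤ 4 * N) : 1 / 16 ≤ (1 - s) ^ a := by
  have hN' : (1 : ℝ) ≤ N := by exact_mod_cast hN
  have hs0 : 0 < s := by rw [hs]; positivity
  have hs1 : s ≤ 1 := by rw [hs, div_le_one (by positivity)]; linarith
  have h := one_add_mul_le_pow (a := -s) (by linarith) N
  have h2 : 1 + (N : ℝ) * -s = 1 / 2 := by rw [hs]; field_simp; norm_num
  rw [h2, ← sub_eq_add_neg] at h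
  calc (1 : ℝ) / 16 = (1 / 2) ^ 4 := by norm_num
    _ ≤ ((1 - s) ^ N) ^ 4 := pow_le_pow_left₀ (by norm_num) h 4
    _ = (1 - s) ^ (4 * N) := by rw [← pow_mul, mul_comm]
    _ ≤ _ := pow_le_pow_of_le_one (by linarith) (by linarith) ha

end RandomSubset

/-! ### Random subsets on which two distributions have distinct conditional probabilities -/

section Detection

variable {α : Type} [Fintype α] [DecidableEq α]

/-- Conditioning on `S` yields probabilities of some element that differ by at least `δ`. -/
def CondDiffer (p q : α → ℝ) (δ : ℝ) (S : Finset α) : Prop :=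
  0 < ∑ l ∈ S, p l ∧ 0 < ∑ l ∈ S, q l ∧
    ∃ i ∈ S, δ ≤ |p i / ∑ l ∈ S, p l - q i / ∑ l ∈ S, q l|

omit [Fintype α] [DecidableEq α] in
theorem CondDiffer.symm {p q : α → ℝ} {δ : ℝ} {S : Finset α} (h : CondDiffer p q δ S) :
    CondDiffer q p δ S := by
  obtain ⟨h1, h2, i, hi, h3⟩ := h
  exact ⟨h2, h1, i, hi, by rwa [abs_sub_comm]⟩

-- With `x = p i / P` the numerator satisfies `x Q - q i = d i - x (P - Q) ≥ (1 - x) d i + x τ ≥ τ`,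
-- where `d i = p i - q i`.
omit [Fintype α] in
theorem condDiffer_of_erase {p q : α → ℝ} (hp : ∀ i, 0 ≤ p i) (hq : ∀ i, 0 ≤ q i) {S : Finset α}
    {i : α} (hi : i ∈ S) {τ M : ℝ} (hτ : 0 < τ) (hd : τ ≤ p i - q i)
    (hS : ∑ l ∈ S.erase i, (p l - q l) ≤ -τ) (hM : ∑ l ∈ S, q l ≤ M) :
    CondDiffer p q (τ / M) S := by
  have hP := Finset.add_sum_erase S p hi
  have hQ := Finset.add_sum_erase S q hi
  rw [Finset.sum_sub_distrib] at hS
  have hp' : 0 ≤ ∑ l ∈ S.erase i, p l := Finset.sum_nonneg fun l _ => hp l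
  set P := ∑ l ∈ S, p l
  set Q := ∑ l ∈ S, q l
  have hpi : 0 < p i := by linarith [hq i]
  have hP0 : 0 < P := by linarith
  have hQ0 : 0 < Q := by linarith [hq i]
  refine ⟨hP0, hQ0, i, hi, le_trans ?_ (le_abs_self _)⟩
  set x := p i / P with hx
  have hx0 : 0 ≤ x := by positivity
  have hx1 : x ≤ 1 := by rw [hx, div_le_one hP0]; linarith
  have hxP : x * P = p i := div_mul_cancel₀ _ hP0.ne'
  calc τ / M ≤ τ / Q := by gcongr
    _ ≤ (x * Q - q i) / Q := by
        gcongr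
        have : x * (P - Q) ≤ x * (p i - q i - τ) := mul_le_mul_of_nonneg_left (by linarith) hx0
        have : 0 ≤ (1 - x) * (p i - q i - τ) := mul_nonneg (by linarith) (by linarith)
        nlinarith
    _ = x - q i / Q := by field_simp

-- The first alternative of `hneg` uses sets with one heavy element, the second uses sets with a
-- positive and a negative heavy element. In both, the `d`-sum of the rest of the set is at most
-- `-t` once the light part does not exceed its mean by more than `t`.
open Classical in
theorem subsetExp_condDiffer_ge_of_bucket {p q : α → ℝ} (hp : ∀ i, 0 ≤ p i) (hq : ∀ i, 0 ≤ q i)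
    (hq1 : ∑ i, q i = 1) {e : ℝ} (he : 0 < e)
    (hd : ∑ i, |p i - q i| = 2 * e) {L : ℝ} (hL : 1 ≤ L) {N : ℕ} (hN : 0 < N) {s : ℝ}
    (hs : s = 1 / (2 * N))
    (hpos : e / (8 * L) ≤
      ∑ i with e * s < p i - q i ∧ p i - q i ≤ 2 * (e * s), (p i - q i))
    (hneg : (∑ i with |p i - q i| ≤ e * s, (p i - q i)) ≤ -(e / (8 * L)) ∨
      e / (8 * L) ≤ (∑ i with e * s < q i - p i ∧ q i - p i ≤ 2 * (e * s), (q i - p i)) ∧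
      (∑ i with |p i - q i| ≤ e * s, (p i - q i)) ≤ 0) :
    1 / (16384 * 1026 * L ^ 4) ≤ subsetExp s Finset.univ
      fun S => if CondDiffer p q (e / (17440 * L ^ 3)) S then 1 else 0 := by
  have hN' : (1 : ℝ) ≤ N := by exact_mod_cast hN
  have hs0 : 0 < s := by rw [hs]; positivity
  have hs1 : s ≤ 1 := by rw [hs, div_le_one (by positivity)]; linarith
  have hL0 : 0 < L := by linarith
  set U : Finset α := Finset.univ.filter fun i => |p i - q i| ≤ e * s with hU
  set A : Finset α := Finset.univ.filter fun i => ¬ |p i - q i| ≤ e * s with hA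
  have hAU : Disjoint A U := (Finset.disjoint_filter_filter_not _ _ _).symm
  have huniv : (Finset.univ : Finset α) = A ∪ U := by
    rw [Finset.union_comm]; exact (Finset.filter_union_filter_not_eq _ _).symm
  set G := ∑ i ∈ U, (p i - q i) with hG
  have hAcard : A.card ≤ 4 * N := by
    have h1 : (A.card : ℝ) * (e * s) ≤ 2 * e := by
      calc _ = ∑ i ∈ A, e * s := by simp
        _ ≤ ∑ i ∈ A, |p i - q i| :=
          Finset.sum_le_sum fun i hi => (not_le.mp (Finset.mem_filter.mp hi).2).le
        _ ≤ ∑ i, |p i - q i| :=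
          Finset.sum_le_sum_of_subset_of_nonneg (Finset.subset_univ _) fun i _ _ => abs_nonneg _
        _ = _ := hd
    have h2 : (A.card : ℝ) ≤ 4 * N := by
      have : ∀ x : ℝ, x * (e * s) = x / (4 * N) * (2 * e) := fun x => by
        rw [hs]; field_simp; norm_num
      rw [this] at h1
      have h3 : (A.card : ℝ) / (4 * N) ≤ 1 := by nlinarith
      rwa [div_le_one (by positivity)] at h3
    exact_mod_cast h2
  have hApow := one_sub_pow_card_ge hN hs hAcard
  have hfac : ∀ r : ℕ, s ^ r * (1 / 16) * (1 / (1026 * L ^ 2)) ≤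
      s ^ r * (1 - s) ^ A.card * (1 / (1026 * L ^ 2)) := fun r =>
    mul_le_mul_of_nonneg_right (mul_le_mul_of_nonneg_left hApow (by positivity)) (by positivity)
  set t := e * s / (16 * L) with ht
  have ht0 : 0 < t := by positivity
  have htes : t ≤ e * s := by
    rw [ht, div_le_iff₀ (by positivity)]
    have : 0 < e * s := by positivity
    nlinarith
  have hst : s * (e / (8 * L)) = 2 * t := by rw [ht]; field_simp; norm_num
  have hV : s * ∑ l ∈ U, (p l - q l) ^ 2 ≤ 2 * (e * s) ^ 2 := by
    have : ∑ l ∈ U, (p l - q l) ^ 2 ≤ e * s * (2 * e) := by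
      calc _ ≤ ∑ l ∈ U, e * s * |p l - q l| := Finset.sum_le_sum fun l hl => by
            rw [← sq_abs, sq]
            exact mul_le_mul_of_nonneg_right (Finset.mem_filter.mp hl).2 (abs_nonneg _)
        _ ≤ ∑ l, e * s * |p l - q l| :=
          Finset.sum_le_sum_of_subset_of_nonneg (Finset.subset_univ _) fun l _ _ => by positivity
        _ = _ := by rw [← Finset.mul_sum, hd]
    nlinarith
  have hqU : ∑ l ∈ U, q l ≤ 1 := by
    rw [← hq1]
    exact Finset.sum_le_sum_of_subset_of_nonneg (Finset.subset_univ _) fun i _ _ => hq i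
  -- Cantelli gives `1 / (512 L² + 1)`, which is at least `2 / (1026 L²)`; the cutoff for `q` is
  -- chosen so that Markov loses only half of this.
  have below : 1 / (1026 * L ^ 2) ≤ subsetExp s U fun S =>
      if ∑ l ∈ S, (p l - q l) ≤ s * G + t ∧ ∑ l ∈ S, q l ≤ 1026 * L ^ 2 * s then 1 else 0 := by
    refine le_trans ?_ (subsetExp_sum_le_and_sum_le hs0.le hs1 ht0 (by positivity) U
      (fun l => p l - q l) q hq hV)
    have h1 : t ^ 2 / (2 * (e * s) ^ 2 + t ^ 2) = 1 / (512 * L ^ 2 + 1) := by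
      rw [ht]; field_simp; ring
    have h2 : 2 / (1026 * L ^ 2) ≤ 1 / (512 * L ^ 2 + 1) := by
      rw [div_le_div_iff₀ (by positivity) (by positivity)]
      nlinarith
    have h3 : s * (∑ l ∈ U, q l) / (1026 * L ^ 2 * s) ≤ 1 / (1026 * L ^ 2) := by
      rw [div_le_div_iff₀ (by positivity) (by positivity)]
      have : 0 < s * (1026 * L ^ 2) := by positivity
      nlinarith
    have h4 : 2 / (1026 * L ^ 2) = 1 / (1026 * L ^ 2) + 1 / (1026 * L ^ 2) := by ring
    rw [h1]
    linarith
  have heq : e / (17440 * L ^ 3) = t / (1090 * L ^ 2 * s) := by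
    rw [ht]; field_simp; norm_num
  have hLL : L ≤ L ^ 2 := by nlinarith
  have extend : ∀ R : Finset α, R ⊆ A → ∀ i ∈ R, t ≤ p i - q i →
      ∑ l ∈ R.erase i, (p l - q l) + s * G ≤ -(2 * t) → ∑ l ∈ R, q l ≤ 64 * L * s →
      1 / (1026 * L ^ 2) ≤ subsetExp s U fun S =>
        if CondDiffer p q (e / (17440 * L ^ 3)) (R ∪ S) then 1 else 0 := by
    intro R hR i hi hti hRG hRq
    refine below.trans (subsetExp_mono hs0.le hs1 fun S hS => ?_)
    by_cases h : ∑ l ∈ S, (p l - q l) ≤ s * G + t ∧ ∑ l ∈ S, q l ≤ 1026 * L ^ 2 * s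
    · rw [if_pos h, if_pos]
      have hRS : Disjoint R S := Finset.disjoint_of_subset_left hR
        (Finset.disjoint_of_subset_right hS hAU)
      have hiS : i ∉ S := Finset.disjoint_left.mp hRS hi
      rw [heq]
      refine condDiffer_of_erase hp hq (Finset.mem_union_left _ hi) ht0 hti ?_ ?_
      · rw [Finset.erase_union_distrib, Finset.erase_eq_of_notMem hiS, Finset.sum_union
          (Finset.disjoint_of_subset_left (Finset.erase_subset _ _) hRS)]
        linarith [h.1]
      · rw [Finset.sum_union hRS]
        have : L * s ≤ L ^ 2 * s := mul_le_mul_of_nonneg_right hLL hs0.le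
        linarith [h.2]
    · rw [if_neg h]; split_ifs <;> norm_num
  have hFnn : ∀ S, (0 : ℝ) ≤ if CondDiffer p q (e / (17440 * L ^ 3)) S then 1 else 0 :=
    fun S => by split_ifs <;> norm_num
  -- The bucket has at least `1 / (16 L s)` elements; the cutoff `q i ≤ 32 L s` discards at most
  -- half of that number.
  have hβ : e / (8 * L) / (2 * (e * s)) - 1 / (32 * L * s) = 1 / (32 * L * s) := by
    field_simp; norm_num
  set B := Finset.univ.filter fun i => e * s < p i - q i ∧ p i - q i ≤ 2 * (e * s) with hB
  set B' := B.filter fun i => q i ≤ 32 * L * s with hB'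
  have hB'card : 1 / (32 * L * s) ≤ B'.card := by
    rw [← hβ]
    refine card_filter_ge_of_sum_ge (by positivity) (by positivity) B (fun i => p i - q i) q
      (fun i hi => (Finset.mem_filter.mp hi).2.2) hpos hq ?_
    rw [← hq1]
    exact Finset.sum_le_sum_of_subset_of_nonneg (Finset.subset_univ _) fun i _ _ => hq i
  have hB'mem : ∀ i ∈ B', e * s < p i - q i ∧ q i ≤ 32 * L * s := fun i hi =>
    ⟨(Finset.mem_filter.mp (Finset.mem_filter.mp hi).1).2.1, (Finset.mem_filter.mp hi).2⟩
  have hB'A : ∀ i ∈ B', i ∈ A := fun i hi => by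
    rw [hA, Finset.mem_filter, not_le]
    exact ⟨Finset.mem_univ _, (hB'mem i hi).1.trans_le (le_abs_self _)⟩
  rw [huniv]
  rcases hneg with hG' | ⟨hneg, hG'⟩
  · refine le_trans ?_ (card_mul_le_subsetExp_union (r := 1) hs0.le hs1
      (show (0 : ℝ) ≤ 1 / (1026 * L ^ 2) by positivity) hAU hFnn B' (fun i => {i})
      (fun i _ j _ h => Finset.singleton_injective h) (fun i hi => by simpa using hB'A i hi)
      (fun i _ => Finset.card_singleton i) fun i hi => extend {i} (by simpa using hB'A i hi) i
        (Finset.mem_singleton_self i) (htes.trans (hB'mem i hi).1.le) ?_ ?_)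
    · calc 1 / (16384 * 1026 * L ^ 4)
          ≤ 1 / (512 * 1026 * L ^ 3) := by
            gcongr <;> norm_num [hL]
        _ = 1 / (32 * L * s) * (s ^ 1 * (1 / 16) * (1 / (1026 * L ^ 2))) := by
            field_simp; norm_num
        _ ≤ _ := mul_le_mul hB'card (hfac 1) (by positivity) (Nat.cast_nonneg _)
    · have h2 : s * G ≤ s * (-(e / (8 * L))) := mul_le_mul_of_nonneg_left hG' hs0.le
      rw [Finset.erase_singleton, Finset.sum_empty]
      linarith
    · rw [Finset.sum_singleton]
      have : 0 < L * s := by positivity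
      linarith [(hB'mem i hi).2]
  · set C := Finset.univ.filter fun i => e * s < q i - p i ∧ q i - p i ≤ 2 * (e * s) with hC
    set C' := C.filter fun i => q i ≤ 32 * L * s with hC'
    have hC'card : 1 / (32 * L * s) ≤ C'.card := by
      rw [← hβ]
      refine card_filter_ge_of_sum_ge (by positivity) (by positivity) C (fun i => q i - p i) q
        (fun i hi => (Finset.mem_filter.mp hi).2.2) hneg hq ?_
      rw [← hq1]
      exact Finset.sum_le_sum_of_subset_of_nonneg (Finset.subset_univ _) fun i _ _ => hq i
    have hC'mem : ∀ i ∈ C', e * s < q i - p i ∧ q i ≤ 32 * L * s := fun i hi =>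
      ⟨(Finset.mem_filter.mp (Finset.mem_filter.mp hi).1).2.1, (Finset.mem_filter.mp hi).2⟩
    have hC'A : ∀ i ∈ C', i ∈ A := fun i hi => by
      rw [hA, Finset.mem_filter, not_le, abs_sub_comm]
      exact ⟨Finset.mem_univ _, (hC'mem i hi).1.trans_le (le_abs_self _)⟩
    have hes : 0 < e * s := by positivity
    have hne : ∀ i ∈ B', ∀ k ∈ C', i ≠ k := by
      rintro i hi k hk rfl
      linarith [(hB'mem i hi).1, (hC'mem i hk).1]
    have hsub : ∀ x ∈ B' ×ˢ C', ({x.1, x.2} : Finset α) ⊆ A := fun x hx => by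
      have hx := Finset.mem_product.mp hx
      simp only [Finset.insert_subset_iff, Finset.singleton_subset_iff]
      exact ⟨hB'A _ hx.1, hC'A _ hx.2⟩
    refine le_trans ?_ (card_mul_le_subsetExp_union (r := 2) hs0.le hs1
      (show (0 : ℝ) ≤ 1 / (1026 * L ^ 2) by positivity) hAU hFnn (B' ×ˢ C')
      (fun x => {x.1, x.2}) ?_ hsub
      (fun x hx => Finset.card_pair (hne _ (Finset.mem_product.mp hx).1 _
        (Finset.mem_product.mp hx).2)) fun x hx => extend {x.1, x.2} (hsub x hx) x.1
        (Finset.mem_insert_self _ _) (htes.trans (hB'mem _ (Finset.mem_product.mp hx).1).1.le)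
        ?_ ?_)
    · calc 1 / (16384 * 1026 * L ^ 4)
          = 1 / (32 * L * s) * (1 / (32 * L * s)) * (s ^ 2 * (1 / 16) * (1 / (1026 * L ^ 2))) := by
            field_simp; norm_num
        _ ≤ _ := by
            rw [Finset.card_product, Nat.cast_mul]
            exact mul_le_mul (mul_le_mul hB'card hC'card (by positivity) (Nat.cast_nonneg _))
              (hfac 2) (by positivity) (mul_nonneg (Nat.cast_nonneg _) (Nat.cast_nonneg _))
    · rintro ⟨i, k⟩ hx ⟨i', k'⟩ hx' h
      have hx := Finset.mem_product.mp hx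
      have hx' := Finset.mem_product.mp hx'
      simp only at hx hx' h
      have h1 : i ∈ ({i', k'} : Finset α) := h ▸ Finset.mem_insert_self _ _
      have h2 : k ∈ ({i', k'} : Finset α) :=
        h ▸ Finset.mem_insert_of_mem (Finset.mem_singleton_self _)
      rw [Finset.mem_insert, Finset.mem_singleton] at h1 h2
      have e1 : i = i' := h1.resolve_right (hne i hx.1 k' hx'.2)
      have e2 : k = k' := h2.resolve_left fun h => hne i' hx'.1 k hx.2 h.symm
      rw [e1, e2]
    · have hx := Finset.mem_product.mp hx
      have hnm : x.1 ∉ ({x.2} : Finset α) := by simpa using hne _ hx.1 _ hx.2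
      rw [Finset.erase_insert hnm, Finset.sum_singleton]
      have : s * G ≤ 0 := mul_nonpos_of_nonneg_of_nonpos hs0.le hG'
      have h16 : 2 * t ≤ e * s := by
        rw [← hst]
        have : e / (8 * L) ≤ e := div_le_self he.le (by linarith)
        nlinarith
      linarith [(hC'mem _ hx.2).1]
    · have hx := Finset.mem_product.mp hx
      rw [Finset.sum_pair (hne _ hx.1 _ hx.2)]
      linarith [(hB'mem _ hx.1).2, (hC'mem _ hx.2).2]

/-- If every step fails, then each removal of mass `a k + b k` from `W` lowers `|G|` by at least
that mass minus `4 η`. Summing over the `K` steps contradicts `hlt`. The two alternatives are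
exchanged by `a ↔ b`, `G ↔ -G`, that is, by swapping the two distributions. -/
theorem exists_balanced_step {K : ℕ} {G W a b : ℕ → ℝ} {η : ℝ}
    (hG : ∀ k, G k = G (k + 1) + a k - b k) (hW : ∀ k, W k = W (k + 1) + a k + b k)
    (ha : ∀ k, 0 ≤ a k) (hb : ∀ k, 0 ≤ b k) (hlt : |G 0| + W K + 4 * K * η < W 0) :
    ∃ k < K, (η ≤ a k ∧ (G (k + 1) ≤ -η ∨ η ≤ b k ∧ G (k + 1) ≤ 0)) ∨
      (η ≤ b k ∧ (η ≤ G (k + 1) ∨ η ≤ a k ∧ 0 ≤ G (k + 1))) := by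
  by_contra! hcon
  have step : ∀ k ≤ K, |G k| + W 0 ≤ |G 0| + W k + 4 * k * η := by
    intro k hk
    induction k with
    | zero => simp
    | succ k ih =>
      have ih := ih (by omega)
      obtain ⟨h1, h2⟩ := hcon k (by omega)
      have hGk := hG k
      have hWk := hW k
      have hak := ha k
      have hbk := hb k
      push_cast
      suffices |G (k + 1)| + a k + b k ≤ |G k| + 4 * η by linarith
      have ha1 := le_abs_self (G k)
      have ha2 := neg_le_abs (G k)
      rcases le_or_gt η (a k) with hA | hA
      · obtain ⟨h3, h4⟩ := h1 hA
        rcases le_or_gt η (b k) with hB | hB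
        · obtain ⟨_, h5⟩ := h2 hB
          linarith [h4 hB, h5 hA]
        · rcases abs_cases (G (k + 1)) with h | h <;> linarith
      · rcases le_or_gt η (b k) with hB | hB
        · obtain ⟨h5, _⟩ := h2 hB
          rcases abs_cases (G (k + 1)) with h | h <;> linarith
        · rcases abs_cases (G (k + 1)) with h | h <;> linarith
  have := step K le_rfl
  linarith [abs_nonneg (G K)]

open Classical in
theorem exists_subsetExp_condDiffer_ge {p q : α → ℝ} (hp : ∀ i, 0 ≤ p i) (hq : ∀ i, 0 ≤ q i)
    (hp1 : ∑ i, p i = 1) (hq1 : ∑ i, q i = 1) {e : ℝ} (he : 0 < e)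
    (hd : ∑ i, |p i - q i| = 2 * e) {L : ℕ} (hL : 1 ≤ L) (hcard : 2 ≤ Fintype.card α)
    (hαL : Fintype.card α ≤ 2 ^ L) :
    ∃ j ∈ Finset.Icc 1 (2 * L), 1 / (16384 * 1026 * (L : ℝ) ^ 4) ≤
      subsetExp ((2 : ℝ) ^ j)⁻¹ Finset.univ
        fun S => if CondDiffer p q (e / (17440 * (L : ℝ) ^ 3)) S then 1 else 0 := by
  have hL' : (1 : ℝ) ≤ L := by exact_mod_cast hL
  set d : α → ℝ := fun i => p i - q i with hddef
  set θ : ℕ → ℝ := fun k => e * ((2 : ℝ) ^ k)⁻¹ with hθ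
  have hθ0 : ∀ k, 0 < θ k := fun k => by positivity
  have hθs : ∀ k, θ k = 2 * θ (k + 1) := fun k => by
    simp only [hθ, pow_succ]; field_simp
  set a : ℕ → ℝ := fun k => ∑ i with θ (k + 1) < d i ∧ d i ≤ 2 * θ (k + 1), d i with ha
  set b : ℕ → ℝ := fun k => ∑ i with θ (k + 1) < -d i ∧ -d i ≤ 2 * θ (k + 1), -d i with hb
  set G : ℕ → ℝ := fun k => ∑ i with |d i| ≤ θ k, d i with hG
  set W : ℕ → ℝ := fun k => ∑ i with |d i| ≤ θ k, |d i| with hW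
  have hdsum : ∑ i, d i = 0 := by rw [Finset.sum_sub_distrib, hp1, hq1, sub_self]
  -- Since `d` sums to zero, `|d i|` is at most the sum of the other absolute values, hence at most
  -- half of `2 * e`. So no element is lost at the top scale.
  have hde : ∀ i, |d i| ≤ θ 0 := by
    intro i
    have h1 := Finset.add_sum_erase Finset.univ d (Finset.mem_univ i)
    have h2 := Finset.add_sum_erase Finset.univ (fun i => |d i|) (Finset.mem_univ i)
    have h3 := Finset.abs_sum_le_sum_abs d (Finset.univ.erase i)
    have h4 : ∑ l ∈ Finset.univ.erase i, d l = -d i := by linarith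
    rw [h4, abs_neg] at h3
    have h5 : θ 0 = e := by simp [hθ]
    rw [h5]
    have h6 : ∑ i, |d i| = 2 * e := hd
    have h7 : |d i| + ∑ l ∈ Finset.univ.erase i, |d l| = ∑ i, |d i| := h2
    linarith
  have hG0 : G 0 = 0 := by
    rw [← hdsum]
    exact Finset.sum_congr (Finset.filter_true_of_mem fun i _ => hde i) fun _ _ => rfl
  have hW0 : W 0 = 2 * e := by
    rw [← hd]
    exact Finset.sum_congr (Finset.filter_true_of_mem fun i _ => hde i) fun _ _ => rfl
  have hGs : ∀ k, G k = G (k + 1) + a k - b k := by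
    intro k
    simp only [hG, ha, hb, Finset.sum_filter]
    rw [← Finset.sum_add_distrib, ← Finset.sum_sub_distrib]
    refine Finset.sum_congr rfl fun i _ => ?_
    have h1 := hθs k
    have h2 := hθ0 (k + 1)
    rw [h1]
    split_ifs <;> rcases abs_cases (d i) with h | h <;> grind
  have hWs : ∀ k, W k = W (k + 1) + a k + b k := by
    intro k
    simp only [hW, ha, hb, Finset.sum_filter]
    rw [← Finset.sum_add_distrib, ← Finset.sum_add_distrib]
    refine Finset.sum_congr rfl fun i _ => ?_
    have h1 := hθs k
    have h2 := hθ0 (k + 1)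
    rw [h1]
    split_ifs <;> rcases abs_cases (d i) with h | h <;> grind
  have ha0 : ∀ k, 0 ≤ a k := fun k => Finset.sum_nonneg fun i hi =>
    ((hθ0 (k + 1)).trans (Finset.mem_filter.mp hi).2.1).le
  have hb0 : ∀ k, 0 ≤ b k := fun k => Finset.sum_nonneg fun i hi =>
    ((hθ0 (k + 1)).trans (Finset.mem_filter.mp hi).2.1).le
  -- Here the range of `j` has to reach `2 * L`: the elements below the last scale have mass at most
  -- `2 ^ L * e / 4 ^ L`. With `η = e / (8 L)` the loss `4 * K * η` is exactly `e`, leaving room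
  -- below `W 0 = 2 * e`.
  have hWK : W (2 * L) ≤ e / 2 := by
    have hc2 : (2 : ℝ) ≤ Fintype.card α := by exact_mod_cast hcard
    have hcL : (Fintype.card α : ℝ) ≤ 2 ^ L := by exact_mod_cast hαL
    calc W (2 * L) ≤ ∑ i with |d i| ≤ θ (2 * L), θ (2 * L) :=
          Finset.sum_le_sum fun i hi => (Finset.mem_filter.mp hi).2
      _ ≤ ∑ i : α, θ (2 * L) := Finset.sum_le_sum_of_subset_of_nonneg (Finset.filter_subset _ _)
          fun i _ _ => (hθ0 _).le
      _ = Fintype.card α * (e * ((2 : ℝ) ^ (2 * L))⁻¹) := by simp [hθ]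
      _ ≤ 2 ^ L * (e * ((2 : ℝ) ^ (2 * L))⁻¹) := by gcongr
      _ = e / 2 ^ L := by rw [two_mul, pow_add]; field_simp
      _ ≤ e / 2 := by gcongr; linarith
  obtain ⟨k, hk, hcase⟩ := exists_balanced_step (K := 2 * L) (η := e / (8 * L)) hGs hWs ha0 hb0 (by
    rw [hG0, hW0, abs_zero]
    have : 4 * ((2 * L : ℕ) : ℝ) * (e / (8 * L)) = e := by push_cast; field_simp; norm_num
    rw [this]
    linarith)
  refine ⟨k + 1, Finset.mem_Icc.mpr ⟨by omega, by omega⟩, ?_⟩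
  have hs : ((2 : ℝ) ^ (k + 1))⁻¹ = 1 / (2 * (2 ^ k : ℕ)) := by
    rw [pow_succ]; push_cast; rw [one_div, mul_comm]
  rcases hcase with ⟨h1, h2⟩ | ⟨h1, h2⟩
  · refine subsetExp_condDiffer_ge_of_bucket hp hq hq1 he hd hL' (by positivity) hs h1 ?_
    simpa only [hG, hb, hddef, neg_sub] using h2
  · have hd' : ∑ i, |q i - p i| = 2 * e := by
      rw [← hd]; exact Finset.sum_congr rfl fun i _ => abs_sub_comm _ _
    have h3 := subsetExp_condDiffer_ge_of_bucket hq hp hp1 he hd' hL' (by positivity) hs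
      (by simpa only [hb, hddef, neg_sub] using h1) (by
        have : ∑ i with |q i - p i| ≤ e * ((2 : ℝ) ^ (k + 1))⁻¹, (q i - p i) = -G (k + 1) := by
          simp only [hG, hddef, ← Finset.sum_neg_distrib, neg_sub]
          refine Finset.sum_congr (Finset.filter_congr fun i _ => ?_) fun _ _ => rfl
          rw [abs_sub_comm]
        rw [this]
        rcases h2 with h2 | ⟨h2, h2'⟩
        · left; linarith
        · right; exact ⟨h2, by linarith⟩)
    refine h3.trans (subsetExp_mono (by positivity) (inv_le_one_of_one_le₀
      (one_le_pow₀ (by norm_num))) fun S _ => ?_)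
    by_cases h : CondDiffer q p (e / (17440 * (L : ℝ) ^ 3)) S
    · rw [if_pos h, if_pos h.symm]
    · rw [if_neg h]; split_ifs <;> norm_num

end Detection

/-! ### The law of the output of a non-adaptive algorithm -/

theorem toReal_condOracle_apply {n : ℕ} (p : PMF (Fin n)) (S : QuerySet n)
    (h : 0 < ∑ l ∈ S.1, (p l).toReal) {i : Fin n} (hi : i ∈ S.1) :
    (condOracle p S i).toReal = (p i).toReal / ∑ l ∈ S.1, (p l).toReal := by
  classical
  have hex : ∃ l ∈ (S.1 : Set (Fin n)), l ∈ p.support := by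
    obtain ⟨l, hl, hpl⟩ := Finset.exists_ne_zero_of_sum_ne_zero h.ne'
    exact ⟨l, hl, (p.mem_support_iff l).mpr fun h0 => hpl (by rw [h0, ENNReal.toReal_zero])⟩
  rw [condOracle, dif_pos hex, PMF.filter_apply, Set.indicator_of_mem (Finset.mem_coe.mpr hi),
    tsum_fintype, ENNReal.toReal_mul, ENNReal.toReal_inv, div_eq_mul_inv,
    Finset.sum_indicator_eq_sum_filter, ENNReal.toReal_sum fun l _ => p.apply_ne_top l]
  simp

/-- A union bound over the failures of the two oracles' samples, in the iterated form in which `run`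
presents them. -/
theorem one_sub_le_pmfExp_pmfPr {α β : Type} [Fintype α] [Fintype β] (μ : PMF α) (ν : PMF β)
    {A : α → Prop} {B : β → Prop} {R : α → β → Prop} (h : ∀ a b, ¬ A a → ¬ B b → R a b) :
    1 - pmfPr μ A - pmfPr ν B ≤ pmfExp μ fun a => pmfPr ν (R a) := by
  classical
  have h1 : ∀ a, (1 - pmfPr ν B) - (if A a then 1 else 0) ≤ pmfPr ν (R a) := by
    intro a
    by_cases hA : A a
    · rw [if_pos hA]
      linarith [pmfPr_nonneg ν B, pmfPr_nonneg ν (R a)]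
    · rw [if_neg hA, sub_zero, ← pmfPr_not]
      exact pmfPr_mono ν fun b hb => h a b hA hb
  refine le_trans ?_ (pmfExp_mono μ h1)
  rw [pmfExp_sub, pmfExp_const]
  exact le_of_eq (by rw [pmfPr]; ring)

/-! ### The random sets of ANACONDA -/

theorem toReal_randomSubset_apply {n : ℕ} (j : ℕ) (S : Finset (Fin n)) :
    (randomSubset n j S).toReal =
      ((2 : ℝ) ^ j)⁻¹ ^ S.card * (1 - ((2 : ℝ) ^ j)⁻¹) ^ (Finset.univ \ S).card := by
  have h1 : ((2 : ℝ≥0∞) ^ j)⁻¹ ≤ 1 := ENNReal.inv_le_one.mpr (one_le_pow₀ (by norm_num))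
  have e1 : Finset.univ.filter (fun i => i ∈ S) = S := by ext i; simp
  have e2 : Finset.univ.filter (fun i => i ∉ S) = Finset.univ \ S := by ext i; simp
  rw [randomSubset, PMF.ofFintype_apply, Finset.prod_ite, e1, e2, Finset.prod_const,
    Finset.prod_const, ENNReal.toReal_mul, ENNReal.toReal_pow, ENNReal.toReal_pow,
    ENNReal.toReal_sub_of_le h1 ENNReal.one_ne_top]
  simp

open Classical in
theorem subsetExp_le_pmfPr_roundSet {n : ℕ} (hn : 2 ≤ n) {j : ℕ}
    (hj : j ∈ Finset.Icc 1 (2 * Nat.clog 2 n)) (P : Finset (Fin n) → Prop) :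
    1 / (2 * (Nat.clog 2 n : ℝ)) *
        subsetExp ((2 : ℝ) ^ j)⁻¹ Finset.univ (fun S => if P S then 1 else 0) ≤
      pmfPr (roundSet n hn) P := by
  rw [subsetExp, Finset.powerset_univ, Finset.mul_sum, pmfPr, pmfExp]
  refine Finset.sum_le_sum fun S _ => ?_
  rw [← mul_assoc]
  refine mul_le_mul_of_nonneg_right ?_ (by split_ifs <;> norm_num)
  have h1 : (((2 * Nat.clog 2 n : ℕ) : ℝ≥0∞)⁻¹ * randomSubset n j S) ≤ roundSet n hn S := by
    rw [roundSet, PMF.bind_apply]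
    refine le_trans (le_of_eq ?_) (ENNReal.le_tsum j)
    rw [PMF.uniformOfFinset_apply_of_mem _ hj, Nat.card_Icc, Nat.add_sub_cancel]
  have h2 := ENNReal.toReal_mono ((roundSet n hn).apply_ne_top S) h1
  rw [ENNReal.toReal_mul, ENNReal.toReal_inv, ENNReal.toReal_natCast,
    toReal_randomSubset_apply] at h2
  rw [one_div]
  exact_mod_cast h2

/-- A query set on which the oracles for `p` and `q` answer some element with probabilities that
differ by at least `δ`. -/
def OraclesDiffer {n : ℕ} (p q : PMF (Fin n)) (δ : ℝ) (S : Finset (Fin n)) : Prop :=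
  ∃ h : S.Nonempty, ∃ i ∈ S,
    δ ≤ |(condOracle p ⟨S, h⟩ i).toReal - (condOracle q ⟨S, h⟩ i).toReal|

theorem pmfPr_roundSet_oraclesDiffer_ge {n : ℕ} (hn : 2 ≤ n) (p q : PMF (Fin n)) {ε : ℝ}
    (hε : 0 < ε) (h : ε ≤ dTV p q) :
    1 / (33619968 * (Nat.clog 2 n : ℝ) ^ 6) ≤
      pmfPr (roundSet n hn) (OraclesDiffer p q (ε / (17440 * (Nat.clog 2 n : ℝ) ^ 3))) := by
  classical
  have hL1 : 1 ≤ Nat.clog 2 n := Nat.clog_pos one_lt_two hn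
  set L := Nat.clog 2 n with hL
  have hL' : (1 : ℝ) ≤ L := by exact_mod_cast hL1
  have he : 0 < dTV p q := hε.trans_le h
  obtain ⟨j, hj, hsub⟩ := exists_subsetExp_condDiffer_ge (p := fun i => (p i).toReal)
    (q := fun i => (q i).toReal) (fun _ => ENNReal.toReal_nonneg) (fun _ => ENNReal.toReal_nonneg)
    (sum_toReal_pmf p) (sum_toReal_pmf q) he (by rw [dTV]; ring) hL1 (by simpa using hn)
    (by simpa using Nat.le_pow_clog one_lt_two n)
  refine le_trans ?_ ((subsetExp_le_pmfPr_roundSet hn hj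
    (CondDiffer (fun i => (p i).toReal) (fun i => (q i).toReal)
      (dTV p q / (17440 * (L : ℝ) ^ 3)))).trans (pmfPr_mono _ fun S hS => ?_))
  · refine le_trans ?_ (mul_le_mul_of_nonneg_left hsub (by positivity))
    rw [one_div_mul_one_div]
    refine one_div_le_one_div_of_le (by positivity) ?_
    -- The choice of `j` costs `2 * L`. The argument yields exponent `5`; it is weakened to `6` to
    -- match the prescribed number of rounds.
    calc 2 * (L : ℝ) * (16384 * 1026 * L ^ 4) = 33619968 * L ^ 5 := by ring
      _ ≤ _ := by gcongr; norm_num [hL']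
  · obtain ⟨hP, hQ, i, hi, hd⟩ := hS
    have hne : S.Nonempty := ⟨i, hi⟩
    refine ⟨hne, i, hi, ?_⟩
    rw [toReal_condOracle_apply p ⟨S, hne⟩ hP hi, toReal_condOracle_apply q ⟨S, hne⟩ hQ hi]
    exact le_trans (by gcongr) hd

theorem pmfPr_exists_round_ge {n : ℕ} (hn : 2 ≤ n) (T : ℕ) (P : Finset (Fin n) → Prop) {ρ : ℝ}
    (hρ : ρ ≤ pmfPr (roundSet n hn) P) :
    1 - Real.exp (-(T * ρ)) ≤
      pmfPr (productPMF fun _ : Fin T => roundSet n hn) fun S => ∃ t, P (S t) := by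
  have h := pmfPr_not (productPMF fun _ : Fin T => roundSet n hn) fun S => ∃ t, P (S t)
  simp only [not_exists] at h
  rw [pmfPr_productPMF_forall (fun _ : Fin T => roundSet n hn) fun _ S => ¬ P S] at h
  simp only [pmfPr_not, Finset.prod_const, Finset.card_univ, Fintype.card_fin] at h
  have h1 : 0 ≤ 1 - pmfPr (roundSet n hn) P := by rw [← pmfPr_not]; exact pmfPr_nonneg _ _
  have h2 : (1 - pmfPr (roundSet n hn) P) ^ T ≤ Real.exp (-ρ) ^ T :=
    pow_le_pow_left₀ h1 (by linarith [Real.add_one_le_exp (-ρ)]) T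
  rw [← Real.exp_nat_mul, mul_neg] at h2
  linarith

/-! ### Correctness of ANACONDA -/

section Correctness

variable {n T m : ℕ}

/-- In some round, some empirical frequency of the answers is off by at least `δ`. -/
def SomeDeviation (δ : ℝ) (p : PMF (Fin n)) (S : Fin T → Finset (Fin n))
    (a : {t : Fin T // (S t).Nonempty} × Fin m → Fin n) : Prop :=
  ∃ t : {t : Fin T // (S t).Nonempty}, ∃ i,
    δ ≤ |empirical (fun k => a (t, k)) i - (condOracle p ⟨S t.1, t.2⟩ i).toReal|

theorem pmfPr_someDeviation_le
    {δ : ℝ} (h0 : 0 < δ) (h1 : δ ≤ 1) (hm : 0 < m) (p : PMF (Fin n))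
    (S : Fin T → Finset (Fin n)) [DecidableEq ({t : Fin T // (S t).Nonempty} × Fin m)] :
    pmfPr (productPMF fun k : {t : Fin T // (S t).Nonempty} × Fin m =>
      condOracle p ⟨S k.1.1, k.1.2⟩) (SomeDeviation δ p S) ≤
      T * (4 / δ * Real.exp (-(m * δ ^ 2 / 8))) := by
  refine (pmfPr_exists_le _ _).trans ?_
  calc _ ≤ ∑ _t : {t : Fin T // (S t).Nonempty}, 4 / δ * Real.exp (-(m * δ ^ 2 / 8)) :=
        Finset.sum_le_sum fun t _ => pmfPr_exists_empirical_sub_ge_le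
          (fun k : {t : Fin T // (S t).Nonempty} × Fin m => condOracle p ⟨S k.1.1, k.1.2⟩)
          (condOracle p ⟨S t.1, t.2⟩) (fun k => (t, k)) (fun _ _ h => (Prod.mk.inj h).2)
          (fun _ => rfl) hm h0 h1
    _ = Fintype.card {t : Fin T // (S t).Nonempty} *
        (4 / δ * Real.exp (-(m * δ ^ 2 / 8))) := by simp
    _ ≤ _ := by
        gcongr
        exact (Fintype.card_subtype_le _).trans_eq (Fintype.card_fin T)

theorem anaconda_queriesAtMost (hn : 2 ≤ n) (T m : ℕ) (thr : ℝ) :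
    (anaconda n hn T m thr).QueriesAtMost (T * m) := by
  intro (S : Fin T → Finset (Fin n))
  have h : Fintype.card ({t : Fin T // (S t).Nonempty} × Fin m) ≤ T * m := by
    rw [Fintype.card_prod, Fintype.card_fin]
    exact Nat.mul_le_mul_right m ((Fintype.card_subtype_le _).trans_eq (Fintype.card_fin T))
  exact ⟨h, h⟩

theorem anaconda_output_equal (hn : 2 ≤ n) {thr : ℝ} {p : PMF (Fin n)}
    {S : Fin T → Finset (Fin n)} {a b : {t : Fin T // (S t).Nonempty} × Fin m → Fin n}
    (ha : ¬ SomeDeviation (thr / 2) p S a) (hb : ¬ SomeDeviation (thr / 2) p S b) :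
    (anaconda n hn T m thr).output S a b = Verdict.equal := by
  refine if_neg ?_
  rintro ⟨t, i, _, hi⟩
  simp only [SomeDeviation, not_exists, not_le] at ha hb
  have h1 := abs_lt.mp (ha t i)
  have h2 := abs_lt.mp (hb t i)
  rcases le_abs.mp hi with h | h <;> linarith

theorem anaconda_output_far (hn : 2 ≤ n) {thr : ℝ} {p q : PMF (Fin n)}
    {S : Fin T → Finset (Fin n)} {a b : {t : Fin T // (S t).Nonempty} × Fin m → Fin n}
    (hS : ∃ t, OraclesDiffer p q (2 * thr) (S t))
    (ha : ¬ SomeDeviation (thr / 2) p S a) (hb : ¬ SomeDeviation (thr / 2) q S b) :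
    (anaconda n hn T m thr).output S a b = Verdict.far := by
  obtain ⟨t, ht, i, hi, hd⟩ := hS
  refine if_pos ⟨⟨t, ht⟩, i, hi, ?_⟩
  simp only [SomeDeviation, not_exists, not_le] at ha hb
  have h1 := abs_lt.mp (ha ⟨t, ht⟩ i)
  have h2 := abs_lt.mp (hb ⟨t, ht⟩ i)
  rcases le_abs.mp hd with h | h
  · exact le_abs.mpr (Or.inl (by linarith))
  · exact le_abs.mpr (Or.inr (by linarith))

theorem toReal_run_anaconda (hn : 2 ≤ n) (thr : ℝ) (p q : PMF (Fin n)) (v : Verdict) :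
    ((anaconda n hn T m thr).run p q v).toReal =
      pmfExp (productPMF fun _ : Fin T => roundSet n hn) fun S =>
        pmfExp (productPMF fun k : {t : Fin T // (S t).Nonempty} × Fin m =>
          condOracle p ⟨S k.1.1, k.1.2⟩) fun a =>
          pmfPr (productPMF fun k : {t : Fin T // (S t).Nonempty} × Fin m =>
            condOracle q ⟨S k.1.1, k.1.2⟩) fun b =>
            (anaconda n hn T m thr).output S a b = v := by
  change (((productPMF fun _ : Fin T => roundSet n hn).bind fun S =>
    (productPMF fun k : {t : Fin T // (S t).Nonempty} × Fin m =>
      condOracle p ⟨S k.1.1, k.1.2⟩).bind fun a =>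
    (productPMF fun k : {t : Fin T // (S t).Nonempty} × Fin m =>
      condOracle q ⟨S k.1.1, k.1.2⟩).bind fun b =>
    PMF.pure ((anaconda n hn T m thr).output S a b)) v).toReal = _
  rw [toReal_bind_apply]
  refine congrArg _ (funext fun S => ?_)
  rw [toReal_bind_apply]
  refine congrArg _ (funext fun a => ?_)
  rw [toReal_bind_apply]
  refine congrArg _ (funext fun b => ?_)
  rw [PMF.pure_apply]
  by_cases h : v = (anaconda n hn T m thr).output S a b
  · rw [if_pos h, if_pos h.symm, ENNReal.toReal_one]
  · rw [if_neg h, if_neg (Ne.symm h), ENNReal.toReal_zero]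

/-- Error budget: each oracle's frequencies are all within `thr / 2` except with probability `1 /
12`, so the verdict is right with probability `5 / 6` given the sets. In the far case a
distinguishing set, with gap `2 * thr`, occurs with probability at least `5 / 6` as well, and `25 /
36 ≥ 2 / 3`. -/
theorem anaconda_distinguishesEquivalence (hn : 2 ≤ n) {thr ε : ℝ} (hε : 0 < ε)
    (h0 : 0 < thr) (h1 : thr ≤ 1) (hm : 0 < m)
    (hthr : 2 * thr ≤ ε / (17440 * (Nat.clog 2 n : ℝ) ^ 3))
    (hT : 336199680 * (Nat.clog 2 n : ℝ) ^ 6 ≤ T)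
    (hexp : 96 * (T / thr) ≤ Real.exp (m * thr ^ 2 / 32)) :
    (anaconda n hn T m thr).DistinguishesEquivalence ε := by
  have hdev : ∀ (p : PMF (Fin n)) (S : Fin T → Finset (Fin n)),
      pmfPr (productPMF fun k : {t : Fin T // (S t).Nonempty} × Fin m =>
        condOracle p ⟨S k.1.1, k.1.2⟩) (SomeDeviation (thr / 2) p S) ≤ 1 / 12 := by
    intro p S
    refine (pmfPr_someDeviation_le (by linarith) (by linarith) hm p S).trans ?_
    have e1 : (m : ℝ) * (thr / 2) ^ 2 / 8 = m * thr ^ 2 / 32 := by ring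
    rw [e1, Real.exp_neg]
    have e2 : (T : ℝ) * (4 / (thr / 2) * (Real.exp (m * thr ^ 2 / 32))⁻¹) =
        8 * (T / thr) / Real.exp (m * thr ^ 2 / 32) := by field_simp; ring
    rw [e2, div_le_iff₀ (Real.exp_pos _)]
    linarith
  intro p q
  constructor
  · rintro rfl
    rw [toReal_run_anaconda]
    refine le_trans ?_ (pmfExp_mono _ (f := fun _ => 5 / 6) fun S => ?_)
    · rw [pmfExp_const]; norm_num
    · refine le_trans ?_ (one_sub_le_pmfExp_pmfPr _ _
        (A := SomeDeviation (thr / 2) p S) (B := SomeDeviation (thr / 2) p S)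
        fun a b ha hb => anaconda_output_equal hn ha hb)
      linarith [hdev p S]
  · intro hfar
    rw [toReal_run_anaconda]
    set P := OraclesDiffer p q (2 * thr) with hP
    refine le_trans ?_ (mul_pmfPr_le_pmfExp (c := 5 / 6)
      (P := fun S : Fin T → Finset (Fin n) => ∃ t, P (S t)) _ (fun S => ?_) fun S hS => ?_)
    · have hρ : 1 / (33619968 * (Nat.clog 2 n : ℝ) ^ 6) ≤ pmfPr (roundSet n hn) P :=
        (pmfPr_roundSet_oraclesDiffer_ge hn p q hε hfar).trans (pmfPr_mono _ fun S hS => by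
          obtain ⟨h, i, hi, hd⟩ := hS
          exact ⟨h, i, hi, hthr.trans hd⟩)
      have hge := pmfPr_exists_round_ge hn T P hρ
      have hL : (0 : ℝ) < Nat.clog 2 n := by exact_mod_cast Nat.clog_pos one_lt_two hn
      have hTρ : 10 ≤ T * (1 / (33619968 * (Nat.clog 2 n : ℝ) ^ 6)) := by
        rw [mul_one_div, le_div_iff₀ (by positivity)]
        linarith
      have hex : Real.exp (-(T * (1 / (33619968 * (Nat.clog 2 n : ℝ) ^ 6)))) ≤ 1 / 6 := by
        rw [Real.exp_neg, one_div (6 : ℝ)]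
        refine inv_anti₀ (by norm_num) ?_
        linarith [Real.add_one_le_exp (T * (1 / (33619968 * (Nat.clog 2 n : ℝ) ^ 6)))]
      have h56 : (5 : ℝ) / 6 ≤
          pmfPr (productPMF fun _ : Fin T => roundSet n hn) fun S => ∃ t, P (S t) := by linarith
      calc (2 : ℝ) / 3 ≤ 5 / 6 * (5 / 6) := by norm_num
        _ ≤ _ := mul_le_mul_of_nonneg_left h56 (by norm_num)
    · exact Finset.sum_nonneg fun a _ => mul_nonneg ENNReal.toReal_nonneg (pmfPr_nonneg _ _)
    · refine le_trans ?_ (one_sub_le_pmfExp_pmfPr _ _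
        (A := SomeDeviation (thr / 2) p S) (B := SomeDeviation (thr / 2) q S)
        fun a b ha hb => anaconda_output_far hn hS ha hb)
      linarith [hdev p S, hdev q S]

end Correctness

/-! ### The choice of parameters -/

theorem logb_le_clog {n : ℕ} (hn : 2 ≤ n) : Real.logb 2 n ≤ Nat.clog 2 n := by
  rw [Real.logb_le_iff_le_rpow one_lt_two (by positivity), Real.rpow_natCast]
  exact_mod_cast Nat.le_pow_clog one_lt_two n

theorem one_le_logb {n : ℕ} (hn : 2 ≤ n) : 1 ≤ Real.logb 2 n := by
  rw [Real.le_logb_iff_rpow_le one_lt_two (by positivity), Real.rpow_one]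
  exact_mod_cast hn

theorem clog_le_two_mul_logb {n : ℕ} (hn : 2 ≤ n) : (Nat.clog 2 n : ℝ) ≤ 2 * Real.logb 2 n := by
  have h1 := Nat.clog_pos one_lt_two hn
  have h2 : 2 ^ (Nat.clog 2 n - 1) ≤ n := (Nat.pow_pred_clog_lt_self one_lt_two hn).le
  have h3 : ((Nat.clog 2 n - 1 : ℕ) : ℝ) ≤ Real.logb 2 n := by
    rw [Real.le_logb_iff_rpow_le one_lt_two (by positivity), Real.rpow_natCast]
    exact_mod_cast h2
  rw [Nat.cast_sub h1, Nat.cast_one] at h3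
  linarith [one_le_logb hn]

/-- The order of growth of the number of samples per round. -/
noncomputable def sampleOrder (n : ℕ) (ε : ℝ) : ℝ := Real.logb 2 n ^ 6 / ε ^ 2

/-- The number of rounds. -/
def roundCount (n : ℕ) : ℕ := 336199680 * Nat.clog 2 n ^ 6

/-- The ratio of the distance parameter and the threshold. -/
def thresholdRatio (n : ℕ) : ℝ := 34880 * (Nat.clog 2 n : ℝ) ^ 3

/-- The number of samples per round. -/
noncomputable def sampleCount (n : ℕ) (ε : ℝ) : ℕ :=
  ⌈131072 * 34880 ^ 2 * (sampleOrder n ε * Real.logb 2 (2 + sampleOrder n ε))⌉₊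

theorem one_le_sampleOrder {n : ℕ} (hn : 2 ≤ n) {ε : ℝ} (h0 : 0 < ε) (h1 : ε ≤ 1) :
    1 ≤ sampleOrder n ε := by
  rw [sampleOrder, le_div_iff₀ (by positivity), one_mul]
  exact (pow_le_one₀ h0.le h1).trans (one_le_pow₀ (one_le_logb hn))

theorem one_le_logb_two_add {x : ℝ} (hx : 0 ≤ x) : 1 ≤ Real.logb 2 (2 + x) := by
  rw [Real.le_logb_iff_rpow_le one_lt_two (by positivity), Real.rpow_one]
  linarith

theorem sampleCount_ge (n : ℕ) (ε : ℝ) :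
    131072 * 34880 ^ 2 * (sampleOrder n ε * Real.logb 2 (2 + sampleOrder n ε)) ≤
      sampleCount n ε := Nat.le_ceil _

theorem sampleCount_le {n : ℕ} (hn : 2 ≤ n) {ε : ℝ} (h0 : 0 < ε) (h1 : ε ≤ 1) :
    (sampleCount n ε : ℝ) ≤
      (131072 * 34880 ^ 2 + 1) * (sampleOrder n ε * Real.logb 2 (2 + sampleOrder n ε)) := by
  have hg := one_le_sampleOrder hn h0 h1
  have hl := one_le_logb_two_add (x := sampleOrder n ε) (by linarith)
  have := (Nat.ceil_lt_add_one (a := 131072 * 34880 ^ 2 *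
    (sampleOrder n ε * Real.logb 2 (2 + sampleOrder n ε))) (by positivity)).le
  have h2 : 1 ≤ sampleOrder n ε * Real.logb 2 (2 + sampleOrder n ε) :=
    one_le_mul_of_one_le_of_one_le hg hl
  rw [sampleCount]
  linarith

theorem pow_le_exp_mul_logb {x : ℝ} (hx : 1 ≤ x) (k : ℕ) :
    x ^ k ≤ Real.exp (k * Real.logb 2 x) := by
  rw [Real.exp_nat_mul]
  refine pow_le_pow_left₀ (by linarith) ?_ k
  calc x = Real.exp (Real.log x) := (Real.exp_log (by linarith)).symm
    _ ≤ _ := Real.exp_le_exp.mpr (by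
      rw [Real.logb, le_div_iff₀ (Real.log_pos one_lt_two)]
      have := Real.log_nonneg hx
      have := Real.log_two_lt_d9
      nlinarith)

/-- With `g = sampleOrder n ε`, the left side is polynomial in `g`, while the factor `logb 2 (2 +
g)` in `sampleCount` makes the right side at least `(2 + g) ^ 64`. -/
theorem mul_rounds_div_threshold_le_exp {n : ℕ} (hn : 2 ≤ n) {ε : ℝ} (h0 : 0 < ε) (h1 : ε ≤ 1) :
    96 * (roundCount n / (ε / thresholdRatio n)) ≤
      Real.exp (sampleCount n ε * (ε / thresholdRatio n) ^ 2 / 32) := by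
  have hl1 := one_le_logb hn
  have hlL := logb_le_clog hn
  have hLl := clog_le_two_mul_logb hn
  have hg := one_le_sampleOrder hn h0 h1
  have hm := sampleCount_ge n ε
  have hlg := one_le_logb_two_add (x := sampleOrder n ε) (by linarith)
  rw [roundCount, thresholdRatio]
  push_cast
  set g := sampleOrder n ε with hgdef
  set l := Real.logb 2 n with hl
  set L : ℝ := (Nat.clog 2 n : ℝ) with hL
  have hL0 : 0 < L := by linarith
  have hge : g * ε ^ 2 = l ^ 6 := div_mul_cancel₀ _ (by positivity)
  have hexp : 64 * Real.logb 2 (2 + g) ≤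
      sampleCount n ε * (ε / (34880 * L ^ 3)) ^ 2 / 32 := by
    have hb : 64 * Real.logb 2 (2 + g) ≤ 131072 * 34880 ^ 2 * (g * Real.logb 2 (2 + g)) *
        (ε / (34880 * L ^ 3)) ^ 2 / 32 := by
      have e1 : 131072 * 34880 ^ 2 * (g * Real.logb 2 (2 + g)) *
        (ε / (34880 * L ^ 3)) ^ 2 / 32 = 64 * Real.logb 2 (2 + g) *
          (64 * (g * ε ^ 2) / L ^ 6) := by field_simp; norm_num
      rw [e1, hge]
      refine le_mul_of_one_le_right (by positivity) ?_
      rw [le_div_iff₀ (by positivity), one_mul]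
      calc L ^ 6 ≤ (2 * l) ^ 6 := pow_le_pow_left₀ hL0.le hLl 6
        _ = _ := by ring
    refine hb.trans ?_
    gcongr
  refine le_trans ?_ ((pow_le_exp_mul_logb (x := 2 + g) (by linarith) 64).trans
    (Real.exp_le_exp.mpr (by exact_mod_cast hexp)))
  have hlε : l ^ 9 / ε ≤ g ^ 2 := by
    rw [hgdef, sampleOrder, div_pow, div_le_div_iff₀ h0 (by positivity), ← pow_mul, ← pow_mul]
    have a1 : l ^ 9 ≤ l ^ 12 := pow_le_pow_right₀ hl1 (by norm_num)
    have a2 : ε ^ 4 ≤ ε := by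
      calc ε ^ 4 ≤ ε ^ 1 := pow_le_pow_of_le_one h0.le h1 (by norm_num)
        _ = ε := pow_one ε
    exact mul_le_mul a1 a2 (by positivity) (by positivity)
  calc 96 * (336199680 * L ^ 6 / (ε / (34880 * L ^ 3)))
      = 96 * 336199680 * 34880 * L ^ 9 / ε := by field_simp
    _ ≤ 96 * 336199680 * 34880 * (2 * l) ^ 9 / ε := by gcongr
    _ = 96 * 336199680 * 34880 * 2 ^ 9 * (l ^ 9 / ε) := by ring
    -- The numerical constant is below `2 ^ 62`; it is absorbed by `62` of the `64` factors `2 + g`,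
    -- the other two covering `l ^ 9 / ε ≤ g ^ 2`.
    _ ≤ 2 ^ 62 * g ^ 2 := by
        refine mul_le_mul (by norm_num) hlε (by positivity) (by positivity)
    _ ≤ (2 + g) ^ 62 * (2 + g) ^ 2 := by gcongr <;> linarith
    _ = (2 + g) ^ 64 := by ring

theorem isThetaOn_roundCount :
    IsThetaOn sizes (fun n => (roundCount n : ℝ)) (fun n => Real.logb 2 n ^ 6) := by
  refine ⟨336199680, 336199680 * 2 ^ 6, by norm_num, by norm_num, fun n hn => ?_⟩
  have hl1 := one_le_logb hn
  simp only [roundCount]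
  push_cast
  rw [mul_assoc, ← mul_pow]
  constructor
  · gcongr
    exact logb_le_clog hn
  · gcongr
    exact clog_le_two_mul_logb hn

theorem isTildeThetaOn_sampleCount :
    IsTildeThetaOn params (fun x => (sampleCount x.1 x.2 : ℝ))
      (fun x => Real.logb 2 x.1 ^ 6 / x.2 ^ 2) := by
  refine ⟨⟨131072 * 34880 ^ 2 + 1, by norm_num, 1, ?_⟩, 131072 * 34880 ^ 2, by norm_num, 0, ?_⟩
  · rintro ⟨n, ε⟩ ⟨hn, h0, h1⟩
    rw [pow_one, mul_assoc]
    exact sampleCount_le hn h0 h1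
  · rintro ⟨n, ε⟩ ⟨hn, h0, h1⟩
    rw [pow_zero, mul_one]
    refine le_trans ?_ (sampleCount_ge n ε)
    have hg := one_le_sampleOrder hn h0 h1
    refine mul_le_mul_of_nonneg_left ?_ (by norm_num)
    exact le_mul_of_one_le_right (le_trans zero_le_one hg)
      (one_le_logb_two_add (le_trans zero_le_one hg))

theorem isTildeThetaOn_thresholdRatio :
    IsTildeThetaOn sizes thresholdRatio (fun n => Real.logb 2 n ^ 3) := by
  refine ⟨⟨34880 * 2 ^ 3, by norm_num, 0, fun n hn => ?_⟩, 34880, by norm_num, 0, fun n hn => ?_⟩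
  · have hl1 := one_le_logb hn
    rw [pow_zero, mul_one, thresholdRatio, mul_assoc, ← mul_pow]
    gcongr
    exact clog_le_two_mul_logb hn
  · have hl1 := one_le_logb hn
    rw [pow_zero, mul_one, thresholdRatio]
    exact mul_le_mul_of_nonneg_left (pow_le_pow_left₀ (by linarith) (logb_le_clog hn) 3)
      (by norm_num)

theorem isTildeOOn_roundCount_mul_sampleCount :
    IsTildeOOn params (fun x => ((roundCount x.1 * sampleCount x.1 x.2 : ℕ) : ℝ))
      (fun x => Real.logb 2 x.1 ^ 12 / x.2 ^ 2) := by
  refine ⟨336199680 * 2 ^ 6 * (131072 * 34880 ^ 2 + 1), by norm_num, 1, ?_⟩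
  rintro ⟨n, ε⟩ ⟨hn, h0, h1⟩
  dsimp only at hn h0 h1 ⊢
  have hl1 := one_le_logb hn
  have hg := one_le_sampleOrder hn h0 h1
  have hT : (roundCount n : ℝ) ≤ 336199680 * (2 * Real.logb 2 n) ^ 6 := by
    rw [roundCount]
    push_cast
    gcongr
    exact clog_le_two_mul_logb hn
  have hgg : sampleOrder n ε ≤ Real.logb 2 n ^ 12 / ε ^ 2 := by
    rw [sampleOrder]
    gcongr; norm_num [hl1]
  have hlog : Real.logb 2 (2 + sampleOrder n ε) ≤
      Real.logb 2 (2 + Real.logb 2 n ^ 12 / ε ^ 2) :=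
    Real.logb_le_logb_of_le one_lt_two (by linarith) (by linarith)
  rw [Nat.cast_mul, pow_one]
  calc (roundCount n : ℝ) * sampleCount n ε
      ≤ 336199680 * (2 * Real.logb 2 n) ^ 6 * ((131072 * 34880 ^ 2 + 1) *
        (sampleOrder n ε * Real.logb 2 (2 + Real.logb 2 n ^ 12 / ε ^ 2))) := by
        refine mul_le_mul hT ((sampleCount_le hn h0 h1).trans ?_) (Nat.cast_nonneg _)
          (by positivity)
        gcongr
    _ = _ := by rw [sampleOrder]; ring

theorem theorem1 :
    ∃ (T : ℕ → ℕ) (m : ℕ → ℝ → ℕ) (D : ℕ → ℝ) (Q : ℕ → ℝ → ℕ),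
      -- the number of rounds, the number of samples per round, the threshold `ε / D n`
      IsThetaOn sizes (fun n => (T n : ℝ)) (fun n => Real.logb 2 n ^ 6) ∧
      IsTildeThetaOn params (fun x => (m x.1 x.2 : ℝ))
        (fun x => Real.logb 2 x.1 ^ 6 / x.2 ^ 2) ∧
      IsTildeThetaOn sizes D (fun n => Real.logb 2 n ^ 3) ∧
      -- the number of queries to each oracle
      IsTildeOOn params (fun x => (Q x.1 x.2 : ℝ))
        (fun x => Real.logb 2 x.1 ^ 12 / x.2 ^ 2) ∧
      ∀ (n : ℕ) (hn : 2 ≤ n) (ε : ℝ), 0 < ε → ε ≤ 1 →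
        (anaconda n hn (T n) (m n ε) (ε / D n)).QueriesAtMost (Q n ε) ∧
        (anaconda n hn (T n) (m n ε) (ε / D n)).DistinguishesEquivalence ε := by
  refine ⟨roundCount, sampleCount, thresholdRatio, fun n ε => roundCount n * sampleCount n ε,
    isThetaOn_roundCount, isTildeThetaOn_sampleCount, isTildeThetaOn_thresholdRatio,
    isTildeOOn_roundCount_mul_sampleCount, fun n hn ε h0 h1 =>
    ⟨anaconda_queriesAtMost hn _ _ _, ?_⟩⟩
  have hL : (1 : ℝ) ≤ Nat.clog 2 n := by exact_mod_cast Nat.clog_pos one_lt_two hn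
  have hg := one_le_sampleOrder hn h0 h1
  have hlg := one_le_logb_two_add (x := sampleOrder n ε) (by linarith)
  have hD : 1 ≤ thresholdRatio n := by
    rw [thresholdRatio]
    linarith [one_le_pow₀ hL (n := 3)]
  refine anaconda_distinguishesEquivalence hn h0 (by positivity) ?_ ?_ ?_ ?_
    (mul_rounds_div_threshold_le_exp hn h0 h1)
  · rw [div_le_one (by positivity)]
    linarith
  · rw [sampleCount, Nat.ceil_pos]
    positivity
  · rw [thresholdRatio]
    exact le_of_eq (by field_simp; norm_num)
  · rw [roundCount]
    push_cast
    exact le_rfl
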